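/- Let $k$ be a field of characteristic zero. A finite quiver $Q$ without oriented cycles is called toupie if it has a unique source $0$ and a unique sink $\omega\neq 0$, and every other vertex is the source of exactly one arrow and the target of exactly one arrow; the paths from $0$ to $\omega$ are called branches. Let $Q$ be a toupie quiver, let $I\subset kQ$ be an admissible ideal and let $A=kQ/I$ be the corresponding toupie algebra. Define the following numbers. - $a$ is the number of arrows from $0$ to $\omega$. - $D=\dim_{k} e_0Ae_\omega$. - $m$ is the number of branches containing a monomial relation, that is, branches having a subpath that lies in $I$. - $r$ is the number of connected components of the graph $Q_\rho$. Its vertices are the branches of length at least $2$ that contain no monomial relation. Fix any linear order of the branches, and let $\rho_1,\dots,\rho_s$ be the basis in reduced row echelon form of the space of linear combinations of branches lying in $I$; two distinct vertices of $Q_\rho$ are joined by an edge if both branches occur with nonzero coefficient in some $\rho_i$. Consider the first Hochschild cohomology $\mathrm{HH}^1(A)$ as a Lie algebra with the Gerstenhaber bracket. Then: 1. $\mathrm{HH}^1(A)$ is abelian if and only if $a=0$ or $D\leq 1$. 2. If $a=0$, then $r+m\geq 1$ and the universal enveloping algebra $\mathcal{U}(\mathrm{HH}^1(A))$ is isomorphic,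 as a $k$-algebra, to the polynomial algebra $k[x_1,\dots,x_{r+m-1}]$. 3. If $a=D=1$, then $\mathcal{U}(\mathrm{HH}^1(A))$ is isomorphic, as a $k$-algebra, to the polynomial algebra $k[y_1,\dots,y_m]$. -/

import Mathlib

universe u v w

open Quiver

namespace ToupieAlg

/-! ### Path algebras of finite quivers -/

section PathAlgebraDef

/-- All paths of a quiver: triples `⟨x, y, p⟩` with `p` a path from `x` to `y`. -/
abbrev AnyPath (V : Type v) [Quiver.{w} V] : Type max v w :=
  Σ x : V, Σ y : V, Path x y

/-- The path algebra `k V`: the vector space with basis the paths of `V`. -/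
def PathAlgebra (k : Type u) [Field k] (V : Type v) [Quiver.{w} V] : Type max u v w :=
  AnyPath V →₀ k

variable {k : Type u} [Field k] {V : Type v} [Quiver.{w} V]

noncomputable instance : AddCommGroup (PathAlgebra k V) :=
  inferInstanceAs (AddCommGroup (AnyPath V →₀ k))

noncomputable instance : Module k (PathAlgebra k V) :=
  inferInstanceAs (Module k (AnyPath V →₀ k))

variable (k) in
/-- The basis vector of the path algebra attached to a path. -/
noncomputable def PathAlgebra.single (p : AnyPath V) : PathAlgebra k V :=
  (Finsupp.single p 1 : AnyPath V →₀ k)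

variable (k) in
/-- The element of the path algebra given by a path from `x` to `y`. -/
noncomputable def PathAlgebra.ofPath {x y : V} (p : Path x y) : PathAlgebra k V :=
  PathAlgebra.single k ⟨x, y, p⟩

variable (k) in
/-- The idempotent `e_x` of a vertex: the path of length zero at `x`. -/
noncomputable def PathAlgebra.vertex (x : V) : PathAlgebra k V :=
  PathAlgebra.ofPath k (Path.nil : Path x x)

open Classical in
variable (k) in
/-- Product of two paths: first `p`, then `q`, if `p` ends where `q` starts, and `0` otherwise. -/
noncomputable def PathAlgebra.mulPath (p q : AnyPath V) : PathAlgebra k V :=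
  if h : p.2.1 = q.1 then
    PathAlgebra.ofPath k (p.2.2.comp (q.2.2.cast h.symm rfl))
  else 0

/-- The bilinear extension of the product of paths. -/
noncomputable def PathAlgebra.mulLin :
    PathAlgebra k V →ₗ[k] PathAlgebra k V →ₗ[k] PathAlgebra k V :=
  Finsupp.linearCombination k fun p : AnyPath V =>
    (Finsupp.linearCombination k fun q : AnyPath V => PathAlgebra.mulPath k p q :
      PathAlgebra k V →ₗ[k] PathAlgebra k V)

noncomputable instance : Mul (PathAlgebra k V) :=
  ⟨fun f g => PathAlgebra.mulLin f g⟩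

/-- The unit of the path algebra: the sum of the idempotents of all vertices. -/
noncomputable instance [Fintype V] : One (PathAlgebra k V) :=
  ⟨∑ x : V, PathAlgebra.vertex k x⟩

theorem PathAlgebra.mul_def (f g : PathAlgebra k V) : f * g = PathAlgebra.mulLin f g := rfl

theorem PathAlgebra.one_def [Fintype V] :
    (1 : PathAlgebra k V) = ∑ x : V, PathAlgebra.vertex k x := rfl

theorem PathAlgebra.mulLin_single (p q : AnyPath V) :
    PathAlgebra.mulLin (PathAlgebra.single k p) (PathAlgebra.single k q) =
      PathAlgebra.mulPath k p q := by
  have h1 : PathAlgebra.mulLin (PathAlgebra.single k p) =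
      (Finsupp.linearCombination k fun q : AnyPath V => PathAlgebra.mulPath k p q) :=
    (Finsupp.linearCombination_single k (1 : k) p).trans (one_smul _ _)
  rw [h1]
  exact (Finsupp.linearCombination_single k (1 : k) q).trans (one_smul _ _)

theorem PathAlgebra.induction {P : PathAlgebra k V → Prop} (f : PathAlgebra k V)
    (zero : P 0) (add : ∀ f g, P f → P g → P (f + g))
    (smul : ∀ (c : k) (p : AnyPath V), P (c • PathAlgebra.single k p)) : P f := by
  refine Finsupp.induction_linear (motive := P) f zero add fun p c => ?_
  have h : (Finsupp.single p c : AnyPath V →₀ k) = c • Finsupp.single p 1 := by simp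
  rw [h]
  exact smul c p

theorem PathAlgebra.mulPath_of_eq {x y z : V} (p : Path x y) (q : Path y z) :
    PathAlgebra.mulPath k ⟨x, y, p⟩ ⟨y, z, q⟩ = PathAlgebra.single k ⟨x, z, p.comp q⟩ := by
  simp [PathAlgebra.mulPath, PathAlgebra.ofPath]

theorem PathAlgebra.mulPath_of_ne {p q : AnyPath V} (h : p.2.1 ≠ q.1) :
    PathAlgebra.mulPath k p q = 0 := by
  simp [PathAlgebra.mulPath, h]

theorem PathAlgebra.mulLin_assoc_single (p q r : AnyPath V) :
    PathAlgebra.mulLin (PathAlgebra.mulPath k p q) (PathAlgebra.single k r) =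
      PathAlgebra.mulLin (PathAlgebra.single k p) (PathAlgebra.mulPath k q r) := by
  obtain ⟨x, y, p⟩ := p
  obtain ⟨y', z, q⟩ := q
  obtain ⟨z', t, r⟩ := r
  by_cases h1 : y = y'
  · subst h1
    by_cases h2 : z = z'
    · subst h2
      simp only [PathAlgebra.mulPath_of_eq, PathAlgebra.mulLin_single, Path.comp_assoc]
    · rw [PathAlgebra.mulPath_of_eq, PathAlgebra.mulLin_single,
        PathAlgebra.mulPath_of_ne (by exact h2), PathAlgebra.mulPath_of_ne (by exact h2), map_zero]
  · rw [PathAlgebra.mulPath_of_ne (by exact h1), map_zero, LinearMap.zero_apply]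
    by_cases h2 : z = z'
    · subst h2
      rw [PathAlgebra.mulPath_of_eq, PathAlgebra.mulLin_single,
        PathAlgebra.mulPath_of_ne (by exact h1)]
    · rw [PathAlgebra.mulPath_of_ne (p := ⟨y', z, q⟩) (by exact h2), map_zero]

theorem PathAlgebra.mulLin_assoc (f g h : PathAlgebra k V) :
    PathAlgebra.mulLin (PathAlgebra.mulLin f g) h =
      PathAlgebra.mulLin f (PathAlgebra.mulLin g h) := by
  induction f using PathAlgebra.induction with
  | zero => simp
  | add f₁ f₂ h₁ h₂ => simp [h₁, h₂]
  | smul c p =>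
    induction g using PathAlgebra.induction with
    | zero => simp
    | add g₁ g₂ h₁ h₂ => simp only [map_add, LinearMap.add_apply, h₁, h₂]
    | smul d q =>
      induction h using PathAlgebra.induction with
      | zero => simp
      | add h₁ h₂ e₁ e₂ => simp only [map_add, e₁, e₂]
      | smul e r =>
        simp only [map_smul, LinearMap.smul_apply, PathAlgebra.mulLin_single,
          PathAlgebra.mulLin_assoc_single]

theorem PathAlgebra.one_mulLin [Fintype V] (f : PathAlgebra k V) :
    PathAlgebra.mulLin 1 f = f := by
  induction f using PathAlgebra.induction with
  | zero => simp
  | add f₁ f₂ h₁ h₂ => rw [map_add, h₁, h₂]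
  | smul c p =>
    obtain ⟨x, y, p⟩ := p
    rw [map_smul, PathAlgebra.one_def, map_sum, LinearMap.sum_apply, Finset.sum_eq_single x]
    · rw [PathAlgebra.vertex, PathAlgebra.ofPath, PathAlgebra.mulLin_single,
        PathAlgebra.mulPath_of_eq, Path.nil_comp]
    · intro z _ hz
      rw [PathAlgebra.vertex, PathAlgebra.ofPath, PathAlgebra.mulLin_single,
        PathAlgebra.mulPath_of_ne (by exact hz)]
    · simp

theorem PathAlgebra.mulLin_one [Fintype V] (f : PathAlgebra k V) :
    PathAlgebra.mulLin f 1 = f := by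
  induction f using PathAlgebra.induction with
  | zero => simp
  | add f₁ f₂ h₁ h₂ => rw [map_add, LinearMap.add_apply, h₁, h₂]
  | smul c p =>
    obtain ⟨x, y, p⟩ := p
    rw [map_smul, LinearMap.smul_apply, PathAlgebra.one_def, map_sum, Finset.sum_eq_single y]
    · rw [PathAlgebra.vertex, PathAlgebra.ofPath, PathAlgebra.mulLin_single,
        PathAlgebra.mulPath_of_eq, Path.comp_nil]
    · intro z _ hz
      rw [PathAlgebra.vertex, PathAlgebra.ofPath, PathAlgebra.mulLin_single,
        PathAlgebra.mulPath_of_ne (by exact hz.symm)]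
    · simp

noncomputable instance [Fintype V] : Ring (PathAlgebra k V) where
  __ := (inferInstance : AddCommGroup (PathAlgebra k V))
  left_distrib f g h := by simp only [PathAlgebra.mul_def, map_add]
  right_distrib f g h := by simp only [PathAlgebra.mul_def, map_add, LinearMap.add_apply]
  zero_mul f := by simp only [PathAlgebra.mul_def, map_zero, LinearMap.zero_apply]
  mul_zero f := by simp only [PathAlgebra.mul_def, map_zero]
  mul_assoc f g h := PathAlgebra.mulLin_assoc f g h
  one_mul f := PathAlgebra.one_mulLin f
  mul_one f := PathAlgebra.mulLin_one f

noncomputable instance [Fintype V] : Algebra k (PathAlgebra k V) :=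
  Algebra.ofModule
    (fun c f g => by simp only [PathAlgebra.mul_def, map_smul, LinearMap.smul_apply])
    (fun c f g => by simp only [PathAlgebra.mul_def, map_smul])

end PathAlgebraDef

/-! ### Toupie quivers and admissible ideals -/

/-- A (finite) quiver is toupie with source `s` and sink `t` if `s` is its unique source, `t ≠ s` is
its unique sink, every other vertex is the target of exactly one arrow and the source of exactly
one arrow, and there are no oriented cycles. -/
structure IsToupie {V : Type v} [Quiver.{w} V] (s t : V) : Prop where
  source_iff : ∀ x : V, (∀ y : V, IsEmpty (y ⟶ x)) ↔ x = s
  sink_iff : ∀ x : V, (∀ y : V, IsEmpty (x ⟶ y)) ↔ x = t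
  source_ne_sink : s ≠ t
  unique_in : ∀ x : V, x ≠ s → x ≠ t → Nonempty (Unique (Σ y : V, (y ⟶ x)))
  unique_out : ∀ x : V, x ≠ s → x ≠ t → Nonempty (Unique (Σ y : V, (x ⟶ y)))
  acyclic : ∀ (x : V) (p : Path x x), p.length = 0

section Invariants

variable {k : Type u} [Field k] {V : Type v} [Fintype V] [Quiver.{w} V]

variable (k V) in
/-- The `n`-th power of the ideal generated by the arrows: the span of the paths of length at
least `n`. -/
noncomputable def arrowPow (n : ℕ) : Submodule k (PathAlgebra k V) :=
  Submodule.span k {f | ∃ (x y : V) (p : Path x y), n ≤ p.length ∧ f = PathAlgebra.ofPath k p}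

/-- An ideal `I` is admissible if `J ^ n ⊆ I ⊆ J ^ 2` for some `n ≥ 2`, where `J` is the ideal
generated by the arrows. -/
def IsAdmissible (I : Ideal (PathAlgebra k V)) : Prop :=
  I.restrictScalars k ≤ arrowPow k V 2 ∧
    ∃ n : ℕ, 2 ≤ n ∧ arrowPow k V n ≤ I.restrictScalars k

/-! ### The numbers `a`, `D`, `m` and `r`

Branches are the paths from the source `s` to the sink `t`. -/

/-- `a`: the number of arrows from the source to the sink. -/
noncomputable def numArrows (s t : V) : ℕ := Nat.card (s ⟶ t)

/-- `D`: the dimension of `e_s A e_t`, where `A = k V / I`. -/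
noncomputable def cornerDim (I : Ideal (PathAlgebra k V)) [I.IsTwoSided] (s t : V) : ℕ :=
  Module.finrank k (LinearMap.range
    (LinearMap.mulLeftRight k
      (Ideal.Quotient.mk I (PathAlgebra.vertex k s), Ideal.Quotient.mk I (PathAlgebra.vertex k t))))

/-- A branch contains a monomial relation if some path that divides it lies in `I`. -/
def ContainsMonomialRelation (I : Ideal (PathAlgebra k V)) {s t : V} (b : Path s t) : Prop :=
  ∃ (x y : V) (p : Path s x) (q : Path x y) (p' : Path y t),
    b = (p.comp q).comp p' ∧ PathAlgebra.ofPath k q ∈ I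

/-- `m`: the number of branches containing monomial relations. -/
noncomputable def numMonomialBranches (I : Ideal (PathAlgebra k V)) (s t : V) : ℕ :=
  Nat.card {b : Path s t // ContainsMonomialRelation I b}

/-- The coefficient vectors of the linear combinations of branches that lie in `I`. -/
noncomputable def relationSpace (I : Ideal (PathAlgebra k V)) (s t : V) :
    Submodule k (Path s t →₀ k) :=
  (I.restrictScalars k).comap
    (Finsupp.linearCombination k fun b : Path s t => PathAlgebra.ofPath k b)

/-- For a fixed order of the branches, `b` is a pivot if it is the leading branch of some
relation. -/
def IsPivot (I : Ideal (PathAlgebra k V)) {s t : V} [LinearOrder (Path s t)] (b : Path s t) :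
    Prop :=
  ∃ ρ ∈ relationSpace I s t, ρ b ≠ 0 ∧ ∀ c < b, ρ c = 0

/-- `ρ` is a row of the reduced row echelon form of the linear relations between branches: its
leading coefficient is `1`, and its coefficients at all other pivots vanish. -/
def IsReducedRelation (I : Ideal (PathAlgebra k V)) {s t : V} [LinearOrder (Path s t)]
    (ρ : Path s t →₀ k) : Prop :=
  ρ ∈ relationSpace I s t ∧
    ∃ b : Path s t, ρ b = 1 ∧ (∀ c < b, ρ c = 0) ∧ ∀ c, c ≠ b → IsPivot I c → ρ c = 0

/-- The graph `Q_ρ`: its vertices are the branches that are not arrows and do not contain monomial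
relations; two of them are joined by an edge if some reduced relation involves both. -/
def relationGraph (I : Ideal (PathAlgebra k V)) (s t : V) [LinearOrder (Path s t)] :
    SimpleGraph {b : Path s t // 2 ≤ b.length ∧ ¬ ContainsMonomialRelation I b} where
  Adj b c := b ≠ c ∧ ∃ ρ : Path s t →₀ k, IsReducedRelation I ρ ∧ ρ b.1 ≠ 0 ∧ ρ c.1 ≠ 0
  symm := ⟨fun _ _ ⟨hne, ρ, hρ, hb, hc⟩ => ⟨hne.symm, ρ, hρ, hc, hb⟩⟩
  loopless := ⟨fun _ h => h.1 rfl⟩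

/-- `r`: the number of connected components of the graph `Q_ρ`. -/
noncomputable def numComponents (I : Ideal (PathAlgebra k V)) (s t : V) [LinearOrder (Path s t)] :
    ℕ :=
  Nat.card (relationGraph I s t).ConnectedComponent

end Invariants

/-! ### The first Hochschild cohomology as a Lie algebra -/

section Hochschild

attribute [local instance 100] LieRing.ofAssociativeRing

variable (k : Type u) [Field k] (A : Type v) [Ring A] [Algebra k A]

/-- The Hochschild differential in degree zero: `a ↦ (x ↦ x a - a x)`. -/
noncomputable def hochschildD0 : A →ₗ[k] Module.End k A :=
  (LinearMap.mul k A).flip - LinearMap.mul k A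

/-- The Hochschild differential in degree one: `f ↦ ((x, y) ↦ x f(y) - f(x y) + f(x) y)`. -/
noncomputable def hochschildD1 : Module.End k A →ₗ[k] A →ₗ[k] A →ₗ[k] A where
  toFun f := LinearMap.mk₂ k (fun x y => x * f y - f (x * y) + f x * y)
    (fun x x' y => by simp only [add_mul, map_add]; abel)
    (fun c x y => by
      simp only [smul_mul_assoc, map_smul, smul_add, smul_sub])
    (fun x y y' => by simp only [mul_add, map_add]; abel)
    (fun c x y => by
      simp only [mul_smul_comm, map_smul, smul_add, smul_sub])
  map_add' f g := by
    ext x y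
    simp only [LinearMap.mk₂_apply, LinearMap.add_apply, mul_add, add_mul]
    abel
  map_smul' c f := by
    ext x y
    simp only [LinearMap.mk₂_apply, LinearMap.smul_apply, mul_smul_comm, smul_mul_assoc,
      smul_add, smul_sub, RingHom.id_apply]

theorem mem_ker_hochschildD1 (f : Module.End k A) :
    f ∈ LinearMap.ker (hochschildD1 k A) ↔ ∀ x y, f (x * y) = x * f y + f x * y := by
  rw [LinearMap.mem_ker]
  constructor
  · intro h x y
    have h1 : x * f y - f (x * y) + f x * y = 0 := LinearMap.congr_fun₂ h x y
    rw [← sub_eq_zero, ← neg_eq_zero, ← h1]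
    abel
  · intro h
    ext x y
    change x * f y - f (x * y) + f x * y = 0
    rw [h x y]
    abel

/-- The Hochschild `1`-cocycles, with the Gerstenhaber bracket `⁅f, g⁆ = f ∘ g - g ∘ f`. -/
noncomputable def hochschildZ1 : LieSubalgebra k (Module.End k A) where
  __ := LinearMap.ker (hochschildD1 k A)
  lie_mem' := by
    intro f g hf hg
    have hf' := (mem_ker_hochschildD1 k A f).1 hf
    have hg' := (mem_ker_hochschildD1 k A g).1 hg
    refine (mem_ker_hochschildD1 k A _).2 fun x y => ?_
    simp only [Ring.lie_def, LinearMap.sub_apply, Module.End.mul_apply, hf', hg', map_add,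
      mul_sub, sub_mul]
    abel

/-- The Hochschild `1`-coboundaries, as an ideal of the Lie algebra of `1`-cocycles. -/
noncomputable def hochschildB1 : LieIdeal k (hochschildZ1 k A) where
  __ := (LinearMap.range (hochschildD0 k A)).comap (hochschildZ1 k A).toSubmodule.subtype
  lie_mem := by
    rintro ⟨f, hf⟩ ⟨g, hg⟩ ⟨a, ha⟩
    have hf' := (mem_ker_hochschildD1 k A f).1 hf
    refine ⟨f a, ?_⟩
    change hochschildD0 k A a = g at ha
    subst ha
    ext x
    change x * f a - f a * x = f (x * a - a * x) - (f x * a - a * f x)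
    rw [map_sub, hf', hf']
    abel

/-- The first Hochschild cohomology `HH¹(A)`, a Lie algebra for the Gerstenhaber bracket. -/
abbrev HH1 : Type v := hochschildZ1 k A ⧸ hochschildB1 k A

end Hochschild

end ToupieAlg

open ToupieAlg

/-! Apart from the pair (source, sink), two vertices of a toupie quiver are joined by at most one
path, so `I` can mix several paths only in the corner of the branches. Admissibility keeps arrows
out of all relations.

Suppose `a = 0` or `D ≤ 1`. Then each arrow spans the corner in which it lies
(`IsToupie.arrowsSpanCorners`). Modulo coboundaries a derivation kills the idempotents, hence
preserves corners, hence multiplies each arrow, and so each path, by a scalar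
(`ArrowsSpanCorners.exists_diagonal`). Diagonal operators commute, so HH¹ is abelian. Its classes
are recorded by the weights of the branches. Any branch weights come from arrow weights; they
respect `I` exactly when they are constant on the support of each row of the reduced echelon form,
that is, on the components of the graph of relations, with no condition on arrows and monomial
branches. The coboundaries are the cocycles whose branches all have the same weight. Hence HH¹
consists of the functions on `r + m + a` classes modulo constants
(`ArrowsSpanCorners.nonempty_HH1_equiv`), and its enveloping algebra is polynomial in `r + m + a -
1` variables. For `a = D = 1` all longer branches lie in `I`, so `r = 0` and `m` variables remain.

If `a > 0` and `D > 1`, two derivations supported on one arrow have a bracket that is not diagonal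
on that arrow, whereas every coboundary is (`IsToupie.not_isLieAbelian`). -/

namespace ToupieAlg

/-! ### Enveloping algebras of abelian Lie algebras -/

section Enveloping

attribute [local instance 100] LieRing.ofAssociativeRing

/-- The images of Lie elements commute, hence so does the subalgebra `S` they generate. Lifting to
`S` and including back is the identity by the universal property, so `S` is everything. -/
theorem UniversalEnvelopingAlgebra.mul_comm_of_isLieAbelian {k : Type u} {L : Type v} [Field k]
    [LieRing L] [LieAlgebra k L] [IsLieAbelian L] (x y : UniversalEnvelopingAlgebra k L) :
    x * y = y * x := by
  have hι : ∀ a b : L, UniversalEnvelopingAlgebra.ι k a * UniversalEnvelopingAlgebra.ι k b =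
      UniversalEnvelopingAlgebra.ι k b * UniversalEnvelopingAlgebra.ι k a := by
    intro a b
    rw [← sub_eq_zero, ← LieRing.of_associative_ring_bracket, ← LieHom.map_lie,
      trivial_lie_zero, map_zero]
  let S := Algebra.adjoin k
    (Set.range (UniversalEnvelopingAlgebra.ι k : L → UniversalEnvelopingAlgebra k L))
  have hS : IsMulCommutative S := Algebra.isMulCommutative_adjoin k
    (by rintro _ ⟨a, rfl⟩ _ ⟨b, rfl⟩; exact hι a b)
  let f : L →ₗ⁅k⁆ S :=
    { toFun := fun a => ⟨UniversalEnvelopingAlgebra.ι k a, Algebra.subset_adjoin ⟨a, rfl⟩⟩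
      map_add' := fun a b => Subtype.ext (map_add _ a b)
      map_smul' := fun c a => Subtype.ext (map_smul _ c a)
      map_lie' := fun {a b} => Subtype.ext (LieHom.map_lie _ a b) }
  have h : S.val.comp (UniversalEnvelopingAlgebra.lift k f) =
      AlgHom.id k (UniversalEnvelopingAlgebra k L) := by
    refine UniversalEnvelopingAlgebra.hom_ext k ?_
    ext a
    change ((UniversalEnvelopingAlgebra.lift k f (UniversalEnvelopingAlgebra.ι k a) : S) :
      UniversalEnvelopingAlgebra k L) = UniversalEnvelopingAlgebra.ι k a
    rw [UniversalEnvelopingAlgebra.lift_ι_apply]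
    rfl
  have hx : ∀ z, ((UniversalEnvelopingAlgebra.lift k f z : S) :
      UniversalEnvelopingAlgebra k L) = z := fun z => DFunLike.congr_fun h z
  rw [← hx x, ← hx y]
  exact congrArg Subtype.val (hS.is_comm.comm (UniversalEnvelopingAlgebra.lift k f x : S)
    (UniversalEnvelopingAlgebra.lift k f y))

theorem UniversalEnvelopingAlgebra.nonempty_equiv_mvPolynomial {k : Type u} {L : Type v} [Field k]
    [LieRing L] [LieAlgebra k L] [IsLieAbelian L] {ι : Type w} (b : Module.Basis ι k L) :
    Nonempty (UniversalEnvelopingAlgebra k L ≃ₐ[k] MvPolynomial ι k) := by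
  -- `MvPolynomial.aeval` in the inverse map requires a commutative target.
  let _ : CommRing (UniversalEnvelopingAlgebra k L) :=
    { (inferInstance : Ring (UniversalEnvelopingAlgebra k L)) with
      mul_comm := UniversalEnvelopingAlgebra.mul_comm_of_isLieAbelian }
  let f : L →ₗ⁅k⁆ MvPolynomial ι k :=
    { b.constr k (MvPolynomial.X : ι → MvPolynomial ι k) with
      map_lie' := fun {x y} => by
        change b.constr k (MvPolynomial.X : ι → MvPolynomial ι k) ⁅x, y⁆ = ⁅_, _⁆
        rw [trivial_lie_zero, map_zero, LieRing.of_associative_ring_bracket, mul_comm, sub_self] }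
  have hf : ∀ i, f (b i) = MvPolynomial.X i := fun i => b.constr_basis k _ i
  refine ⟨AlgEquiv.ofAlgHom (UniversalEnvelopingAlgebra.lift k f)
    (MvPolynomial.aeval fun i => UniversalEnvelopingAlgebra.ι k (b i)) ?_ ?_⟩
  · refine MvPolynomial.algHom_ext fun i => ?_
    simp only [AlgHom.comp_apply, MvPolynomial.aeval_X, AlgHom.id_apply]
    rw [UniversalEnvelopingAlgebra.lift_ι_apply, hf]
  · refine UniversalEnvelopingAlgebra.hom_ext k ?_
    have h : (MvPolynomial.aeval fun i => UniversalEnvelopingAlgebra.ι k (b i)).toLinearMap ∘ₗ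
        (f : L →ₗ[k] MvPolynomial ι k) =
        ((UniversalEnvelopingAlgebra.ι k : L →ₗ⁅k⁆ UniversalEnvelopingAlgebra k L) :
          L →ₗ[k] UniversalEnvelopingAlgebra k L) := by
      refine b.ext fun i => ?_
      change MvPolynomial.aeval (fun i => UniversalEnvelopingAlgebra.ι k (b i)) (f (b i)) =
        UniversalEnvelopingAlgebra.ι k (b i)
      rw [hf, MvPolynomial.aeval_X]
    ext x
    refine (congrArg (MvPolynomial.aeval fun i => UniversalEnvelopingAlgebra.ι k (b i))
      (UniversalEnvelopingAlgebra.lift_ι_apply k f x)).trans (DFunLike.congr_fun h x)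

end Enveloping

/-! ### Paths of toupie quivers -/

section Toupie

variable {V : Type v} [Quiver.{w} V] {s t : V}

theorem IsToupie.isEmpty_hom_source (hQ : IsToupie s t) (y : V) : IsEmpty (y ⟶ s) :=
  (hQ.source_iff s).2 rfl y

theorem IsToupie.isEmpty_sink_hom (hQ : IsToupie s t) (y : V) : IsEmpty (t ⟶ y) :=
  (hQ.sink_iff t).2 rfl y

theorem IsToupie.eq_source_of_path (hQ : IsToupie s t) {x : V} (p : Path x s) : x = s := by
  cases p with
  | nil => rfl
  | cons p e => exact ((hQ.isEmpty_hom_source _).false e).elim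

theorem IsToupie.eq_sink_of_path (hQ : IsToupie s t) {x : V} (p : Path t x) : x = t := by
  induction p with
  | nil => rfl
  | cons p e ih => subst ih; exact ((hQ.isEmpty_sink_hom _).false e).elim

theorem IsToupie.eq_nil (hQ : IsToupie s t) {x : V} (p : Path x x) : p = Path.nil :=
  Path.eq_nil_of_length_zero p (hQ.acyclic x p)

/-- Walking backwards from a vertex other than the sink, the incoming arrow is unique at each step.
-/
theorem IsToupie.subsingleton_path_of_ne_sink (hQ : IsToupie s t) {x y : V} (hy : y ≠ t) :
    Subsingleton (Path x y) := by
  refine ⟨fun p => ?_⟩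
  induction p with
  | nil => exact fun q => (hQ.eq_nil q).symm
  | @cons z y p e ih =>
    intro q
    have hys : y ≠ s := by rintro rfl; exact (hQ.isEmpty_hom_source _).false e
    cases q with
    | nil => exact hQ.eq_nil _
    | @cons z' _ q e' =>
      obtain ⟨hu⟩ := hQ.unique_in y hys hy
      have h : (⟨z, e⟩ : Σ z : V, (z ⟶ y)) = ⟨z', e'⟩ := Subsingleton.elim _ _
      obtain ⟨rfl, h⟩ := Sigma.mk.inj_iff.1 h
      obtain rfl := eq_of_heq h
      have hz : z ≠ t := by rintro rfl; exact (hQ.isEmpty_sink_hom _).false e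
      rw [ih hz q]

/-- Dually, one walks forwards along unique outgoing arrows. Paths are built by appending at the
end, so the induction runs on the length and splits off the first arrow. -/
theorem IsToupie.subsingleton_path_of_ne_source (hQ : IsToupie s t) {x y : V} (hx : x ≠ s) :
    Subsingleton (Path x y) := by
  suffices h : ∀ (n : ℕ) (x : V), x ≠ s → ∀ p q : Path x y, p.length = n → p = q from
    ⟨fun p q => h _ x hx p q rfl⟩
  intro n
  induction n with
  | zero =>
    intro x _ p q hp
    obtain rfl := Path.eq_of_length_zero p hp
    rw [hQ.eq_nil p, hQ.eq_nil q]
  | succ n ih =>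
    intro x hx p q hp
    by_cases hxy : x = y
    · subst hxy
      rw [hQ.eq_nil p, hQ.eq_nil q]
    have hq : q.length ≠ 0 := fun h => hxy (Path.eq_of_length_zero q h)
    obtain ⟨m, hm⟩ := Nat.exists_eq_succ_of_ne_zero hq
    obtain ⟨z, e, p', hp', rfl⟩ := Path.eq_toPath_comp_of_length_eq_succ p hp
    obtain ⟨z', e', q', -, rfl⟩ := Path.eq_toPath_comp_of_length_eq_succ q hm
    have hxt : x ≠ t := by rintro rfl; exact (hQ.isEmpty_sink_hom _).false e
    obtain ⟨hu⟩ := hQ.unique_out x hx hxt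
    have h : (⟨z, e⟩ : Σ z : V, (x ⟶ z)) = ⟨z', e'⟩ := Subsingleton.elim _ _
    obtain ⟨rfl, h⟩ := Sigma.mk.inj_iff.1 h
    obtain rfl := eq_of_heq h
    have hz : z ≠ s := by rintro rfl; exact (hQ.isEmpty_hom_source _).false e
    rw [ih z hz p' q' hp']

theorem IsToupie.subsingleton_path (hQ : IsToupie s t) {x y : V} (h : ¬(x = s ∧ y = t)) :
    Subsingleton (Path x y) := by
  by_cases hx : x = s
  · exact hQ.subsingleton_path_of_ne_sink fun hy => h ⟨hx, hy⟩
  · exact hQ.subsingleton_path_of_ne_source hx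

/-- By acyclicity, being joined by a path of positive length is a strict order on a finite set;
walking backwards along arrows must stop, and it can stop only at the source. -/
theorem IsToupie.nonempty_path [Finite V] (hQ : IsToupie s t) (x : V) : Nonempty (Path s x) := by
  let r : V → V → Prop := fun x y => ∃ p : Path x y, p.length ≠ 0
  have : IsTrans V r := ⟨fun x y z ⟨p, hp⟩ ⟨q, _⟩ => ⟨p.comp q, by rw [Path.length_comp]; omega⟩⟩
  have : Std.Irrefl r := ⟨fun x ⟨p, hp⟩ => hp (hQ.acyclic x p)⟩
  induction x using (Finite.wellFounded_of_trans_of_irrefl r).induction with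
  | _ x ih =>
    by_cases hx : x = s
    · subst hx; exact ⟨Path.nil⟩
    · have h := mt (hQ.source_iff x).1 hx
      push Not at h
      obtain ⟨y, ⟨e⟩⟩ := h
      obtain ⟨p⟩ := ih y ⟨e.toPath, by simp⟩
      exact ⟨p.cons e⟩

theorem IsToupie.length_pos (hQ : IsToupie s t) (b : Path s t) : 0 < b.length :=
  Nat.pos_of_ne_zero fun h => hQ.source_ne_sink (Path.eq_of_length_zero b h)

/-- A branch is determined by its last arrow, since the vertex before the sink is reached by only
one path from the source. -/
theorem IsToupie.finite_branches [Finite V] [∀ x y : V, Finite (x ⟶ y)] (hQ : IsToupie s t) :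
    Finite (Path s t) := by
  have hsurj : ∀ b : Path s t, ∃ z, ∃ (p : Path s z) (e : z ⟶ t), b = p.cons e := fun b =>
    (Path.length_ne_zero_iff_eq_cons b).1 (hQ.length_pos b).ne'
  choose z p e h using hsurj
  refine Finite.of_injective (fun b => (⟨z b, e b⟩ : Σ z : V, (z ⟶ t))) fun b b' hb => ?_
  have key : ∀ (z z' : V) (p : Path s z) (p' : Path s z') (e : z ⟶ t) (e' : z' ⟶ t),
      (⟨z, e⟩ : Σ z : V, (z ⟶ t)) = ⟨z', e'⟩ → p.cons e = p'.cons e' := by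
    intro z z' p p' e e' hz
    obtain ⟨rfl, hz⟩ := Sigma.mk.inj_iff.1 hz
    obtain rfl := eq_of_heq hz
    have hz : z ≠ t := by rintro rfl; exact (hQ.isEmpty_sink_hom _).false e
    have := hQ.subsingleton_path_of_ne_sink (x := s) hz
    rw [Subsingleton.elim p p']
  rw [h b, h b']
  exact key _ _ _ _ _ _ hb

theorem _root_.Quiver.Path.exists_eq_toPath_of_length_eq_one {x y : V} (p : Path x y)
    (h : p.length = 1) : ∃ e : x ⟶ y, p = e.toPath := by
  obtain ⟨z, p', e, rfl⟩ := (Path.length_ne_zero_iff_eq_cons p).1 (by omega)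
  have h' : p'.length = 0 := by simpa using h
  obtain rfl := Path.eq_of_length_zero p' h'
  rw [Path.eq_nil_of_length_zero p' h']
  exact ⟨e, rfl⟩

theorem toPath_injective {x y : V} : Function.Injective (Hom.toPath : (x ⟶ y) → Path x y) := by
  intro e e' h
  exact eq_of_heq (Path.hom_heq_of_cons_eq_cons h)

/-- The total weight of a path for a weight function on the arrows. -/
def pathWeight {k : Type u} [AddMonoid k] (c : ∀ x y : V, (x ⟶ y) → k) :
    ∀ {x y : V}, Path x y → k
  | _, _, Path.nil => 0
  | _, _, Path.cons p e => pathWeight c p + c _ _ e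

section Weight

variable {k : Type u}

@[simp] theorem pathWeight_nil [AddMonoid k] (c : ∀ x y : V, (x ⟶ y) → k) (x : V) :
    pathWeight c (Path.nil : Path x x) = 0 := by rw [pathWeight]

@[simp] theorem pathWeight_cons [AddMonoid k] (c : ∀ x y : V, (x ⟶ y) → k) {x y z : V}
    (p : Path x y) (e : y ⟶ z) : pathWeight c (p.cons e) = pathWeight c p + c _ _ e := by
  rw [pathWeight]

theorem pathWeight_comp [AddMonoid k] (c : ∀ x y : V, (x ⟶ y) → k) {x y z : V}
    (p : Path x y) (q : Path y z) :
    pathWeight c (p.comp q) = pathWeight c p + pathWeight c q := by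
  induction q with
  | nil => simp
  | cons q e ih => simp [ih, add_assoc]

theorem pathWeight_sub_of_potential [AddCommGroup k] (h : V → k) {x y : V} (p : Path x y) :
    pathWeight (fun x y _ => h y - h x) p = h y - h x := by
  induction p with
  | nil => simp
  | cons p e ih => rw [pathWeight_cons, ih]; abel

/-- Every function on the branches of a toupie quiver is the total weight for some weight function
on the arrows. -/
theorem IsToupie.exists_pathWeight_eq [AddCommMonoid k] [Finite V] (hQ : IsToupie s t)
    (l : Path s t → k) : ∃ c : ∀ x y : V, (x ⟶ y) → k, ∀ b : Path s t, pathWeight c b = l b := by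
  classical
  let P : ∀ x : V, Path s x := fun x => Classical.choice (hQ.nonempty_path x)
  -- The whole weight of a branch is put on its last arrow, which determines the branch; arrows not
  -- ending at the sink get weight 0.
  let g : ∀ y : V, Path s y → k := fun y q => if h : y = t then l (h ▸ q) else 0
  let c : ∀ x y : V, (x ⟶ y) → k := fun x y e => g y ((P x).cons e)
  refine ⟨c, fun b => ?_⟩
  have h0 : ∀ {x y : V} (p : Path x y), y ≠ t → pathWeight c p = 0 := by
    intro x y p
    induction p with
    | nil => simp
    | @cons z y p e ih =>
      intro hy
      have hz : z ≠ t := by rintro rfl; exact (hQ.isEmpty_sink_hom _).false e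
      simp [ih hz, c, g, hy]
  obtain ⟨z, p, e, rfl⟩ := (Path.length_ne_zero_iff_eq_cons b).1 (hQ.length_pos b).ne'
  have hz : z ≠ t := by rintro rfl; exact (hQ.isEmpty_sink_hom _).false e
  have := hQ.subsingleton_path_of_ne_sink (x := s) hz
  rw [pathWeight_cons, h0 p hz, zero_add]
  simp [c, g, Subsingleton.elim (P z) p]

end Weight

end Toupie

end ToupieAlg

namespace ToupieAlg

/-! ### Calculus in the path algebra -/

section PathCalculus

variable {k : Type u} [Field k] {V : Type v} [Quiver.{w} V] {s t : V}

variable (k) in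
/-- The coefficient of a path, as a linear form on the path algebra. -/
noncomputable def PathAlgebra.coeff (p : AnyPath V) : PathAlgebra k V →ₗ[k] k :=
  (Finsupp.lapply p : (AnyPath V →₀ k) →ₗ[k] k)

theorem PathAlgebra.coeff_single_self (p : AnyPath V) :
    PathAlgebra.coeff k p (PathAlgebra.single k p) = 1 :=
  Finsupp.single_eq_same

theorem PathAlgebra.coeff_single_of_ne {p q : AnyPath V} (h : q ≠ p) :
    PathAlgebra.coeff k p (PathAlgebra.single k q) = 0 :=
  Finsupp.single_eq_of_ne' h

theorem PathAlgebra.coeff_ofPath_self {x y : V} (p : Path x y) :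
    PathAlgebra.coeff k ⟨x, y, p⟩ (PathAlgebra.ofPath k p) = 1 :=
  PathAlgebra.coeff_single_self _

theorem PathAlgebra.coeff_ofPath_of_ne {x y : V} {p q : Path x y} (h : q ≠ p) :
    PathAlgebra.coeff k ⟨x, y, p⟩ (PathAlgebra.ofPath k q) = 0 :=
  PathAlgebra.coeff_single_of_ne fun h' => h (eq_of_heq (Sigma.mk.inj_iff.1
    (eq_of_heq (Sigma.mk.inj_iff.1 h').2)).2)

theorem PathAlgebra.hom_ext {M : Type*} [AddCommMonoid M] [Module k M]
    {f g : PathAlgebra k V →ₗ[k] M}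
    (h : ∀ p, f (PathAlgebra.single k p) = g (PathAlgebra.single k p)) : f = g :=
  Finsupp.lhom_ext' fun p => LinearMap.ext_ring (h p)

/-- The linear map on the path algebra with given values on the paths. -/
noncomputable def PathAlgebra.lift {M : Type*} [AddCommGroup M] [Module k M] (g : AnyPath V → M) :
    PathAlgebra k V →ₗ[k] M :=
  (Finsupp.linearCombination k g : (AnyPath V →₀ k) →ₗ[k] M)

theorem PathAlgebra.lift_single {M : Type*} [AddCommGroup M] [Module k M] (g : AnyPath V → M)
    (p : AnyPath V) : PathAlgebra.lift g (PathAlgebra.single k p) = g p :=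
  (Finsupp.linearCombination_single k (1 : k) p).trans (one_smul _ _)

theorem PathAlgebra.single_mul_single (p q : AnyPath V) :
    PathAlgebra.single k p * PathAlgebra.single k q = PathAlgebra.mulPath k p q :=
  PathAlgebra.mulLin_single p q

theorem PathAlgebra.ofPath_mul_ofPath {x y z : V} (p : Path x y) (q : Path y z) :
    PathAlgebra.ofPath k p * PathAlgebra.ofPath k q = PathAlgebra.ofPath k (p.comp q) :=
  (PathAlgebra.single_mul_single _ _).trans (PathAlgebra.mulPath_of_eq p q)

theorem PathAlgebra.ofPath_mul_ofPath_of_ne {x y y' z : V} (h : y ≠ y') (p : Path x y)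
    (q : Path y' z) : PathAlgebra.ofPath k p * PathAlgebra.ofPath k q = 0 :=
  (PathAlgebra.single_mul_single _ _).trans (PathAlgebra.mulPath_of_ne h)

theorem PathAlgebra.vertex_mul_ofPath {x y : V} (p : Path x y) :
    PathAlgebra.vertex k x * PathAlgebra.ofPath k p = PathAlgebra.ofPath k p := by
  rw [PathAlgebra.vertex, PathAlgebra.ofPath_mul_ofPath, Path.nil_comp]

theorem PathAlgebra.ofPath_mul_vertex {x y : V} (p : Path x y) :
    PathAlgebra.ofPath k p * PathAlgebra.vertex k y = PathAlgebra.ofPath k p := by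
  rw [PathAlgebra.vertex, PathAlgebra.ofPath_mul_ofPath, Path.comp_nil]

theorem PathAlgebra.vertex_mul_mul_vertex_mem [Fintype V] (f : PathAlgebra k V) (x y : V) :
    PathAlgebra.vertex k x * f * PathAlgebra.vertex k y ∈
      Submodule.span k (Set.range fun p : Path x y => PathAlgebra.ofPath k p) := by
  induction f using PathAlgebra.induction with
  | zero => simp
  | add f g hf hg => rw [mul_add, add_mul]; exact add_mem hf hg
  | smul c p =>
    rw [mul_smul_comm, smul_mul_assoc]
    refine Submodule.smul_mem _ _ ?_
    obtain ⟨x', y', p⟩ := p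
    change PathAlgebra.vertex k x * PathAlgebra.ofPath k p * PathAlgebra.vertex k y ∈ _
    by_cases hx : x = x'
    · subst hx
      rw [PathAlgebra.vertex_mul_ofPath]
      by_cases hy : y' = y
      · subst hy
        rw [PathAlgebra.ofPath_mul_vertex]
        exact Submodule.subset_span ⟨p, rfl⟩
      · rw [PathAlgebra.vertex, PathAlgebra.ofPath_mul_ofPath_of_ne hy]
        exact zero_mem _
    · rw [PathAlgebra.vertex, PathAlgebra.ofPath_mul_ofPath_of_ne hx, zero_mul]
      exact zero_mem _

theorem PathAlgebra.sum_vertex_mul_mul_vertex [Fintype V] (f : PathAlgebra k V) :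
    ∑ x : V, ∑ y : V, PathAlgebra.vertex k x * f * PathAlgebra.vertex k y = f := by
  simp_rw [← Finset.mul_sum, ← Finset.sum_mul]
  rw [← PathAlgebra.one_def, one_mul, mul_one]

theorem coeff_eq_zero_of_mem_arrowPow {n : ℕ} {f : PathAlgebra k V}
    [Fintype V] (hf : f ∈ arrowPow k V n) {p : AnyPath V} (hp : p.2.2.length < n) :
    PathAlgebra.coeff k p f = 0 := by
  induction hf using Submodule.span_induction with
  | mem f hf =>
    obtain ⟨x, y, q, hq, rfl⟩ := hf
    refine PathAlgebra.coeff_single_of_ne ?_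
    rintro rfl
    exact absurd hp (not_lt.2 hq)
  | zero => exact map_zero _
  | add f g _ _ hf hg => rw [map_add, hf, hg, add_zero]
  | smul c f _ hf => rw [map_smul, hf, smul_zero]

/-- The diagonal operator with given diagonal entries. -/
noncomputable def scaleBranches (l : Path s t → k) : (Path s t →₀ k) →ₗ[k] (Path s t →₀ k) :=
  Finsupp.linearCombination k fun b => Finsupp.single b (l b)

theorem scaleBranches_apply (l : Path s t → k) (ρ : Path s t →₀ k) (b : Path s t) :
    scaleBranches l ρ b = l b * ρ b := by
  induction ρ using Finsupp.induction_linear with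
  | zero => simp
  | add ρ σ hρ hσ => rw [map_add, Finsupp.add_apply, hρ, hσ, Finsupp.add_apply, mul_add]
  | single c a =>
    rw [scaleBranches, Finsupp.linearCombination_single, Finsupp.smul_apply]
    by_cases h : c = b
    · subst h
      simp [mul_comm]
    · simp [Finsupp.single_eq_of_ne' h]

end PathCalculus

/-! ### Reduced relations between branches -/

section Relations

variable {k : Type u} [Field k] {V : Type v} [Fintype V] [Quiver.{w} V] {s t : V}
  {I : Ideal (PathAlgebra k V)}

theorem mem_relationSpace {ρ : Path s t →₀ k} :
    ρ ∈ relationSpace I s t ↔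
      Finsupp.linearCombination k (fun b : Path s t => PathAlgebra.ofPath k b) ρ ∈ I :=
  Iff.rfl

theorem single_mem_relationSpace [I.IsTwoSided] {b : Path s t} (hb : ContainsMonomialRelation I b) :
    Finsupp.single b 1 ∈ relationSpace I s t := by
  obtain ⟨x, y, p, q, p', rfl, hq⟩ := hb
  rw [mem_relationSpace, Finsupp.linearCombination_single, one_smul,
    ← PathAlgebra.ofPath_mul_ofPath, ← PathAlgebra.ofPath_mul_ofPath]
  exact I.mul_mem_right _ (I.mul_mem_left _ hq)

theorem coeff_linearCombination (ρ : Path s t →₀ k) (b : Path s t) :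
    PathAlgebra.coeff k ⟨s, t, b⟩
      (Finsupp.linearCombination k (fun b : Path s t => PathAlgebra.ofPath k b) ρ) = ρ b := by
  induction ρ using Finsupp.induction_linear with
  | zero => simp
  | add ρ σ hρ hσ => rw [map_add, map_add, hρ, hσ, Finsupp.add_apply]
  | single c a =>
    rw [Finsupp.linearCombination_single, map_smul]
    by_cases h : c = b
    · subst h
      rw [PathAlgebra.coeff_ofPath_self, Finsupp.single_eq_same, smul_eq_mul, mul_one]
    · rw [PathAlgebra.coeff_ofPath_of_ne h, Finsupp.single_eq_of_ne' h, smul_zero]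

theorem IsAdmissible.coeff_eq_zero (hI : IsAdmissible I) {f : PathAlgebra k V} (hf : f ∈ I)
    {p : AnyPath V} (hp : p.2.2.length < 2) : PathAlgebra.coeff k p f = 0 :=
  coeff_eq_zero_of_mem_arrowPow (hI.1 hf) hp

theorem IsAdmissible.two_le_length (hI : IsAdmissible I) {ρ : Path s t →₀ k}
    (hρ : ρ ∈ relationSpace I s t) {b : Path s t} (hb : ρ b ≠ 0) : 2 ≤ b.length := by
  by_contra h
  rw [← coeff_linearCombination] at hb
  exact hb (hI.coeff_eq_zero (mem_relationSpace.1 hρ) (not_le.1 h))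

variable [LinearOrder (Path s t)]

/-- The smallest branch in the support of a nonzero relation is a pivot. Below, relations are
identified by comparing them at pivots only. -/
theorem eq_zero_of_pivots {ρ : Path s t →₀ k} (hρ : ρ ∈ relationSpace I s t)
    (h : ∀ b, IsPivot I b → ρ b = 0) : ρ = 0 := by
  by_contra hne
  have hs := Finsupp.support_nonempty_iff.2 hne
  refine Finsupp.mem_support_iff.1 (ρ.support.min'_mem hs) (h _ ⟨ρ, hρ, ?_, fun c hc => ?_⟩)
  · exact Finsupp.mem_support_iff.1 (ρ.support.min'_mem hs)
  · by_contra hc'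
    exact absurd (ρ.support.min'_le c (Finsupp.mem_support_iff.2 hc')) (not_le.2 hc)

theorem IsPivot.exists_reduced [Finite (Path s t)] {b : Path s t} (hb : IsPivot I b) :
    ∃ ρ ∈ relationSpace I s t, ρ b = 1 ∧ (∀ c < b, ρ c = 0) ∧
      ∀ c, c ≠ b → IsPivot I c → ρ c = 0 := by
  classical
  cases nonempty_fintype (Path s t)
  -- Back substitution: rows with larger pivots are reduced first.
  induction b using (wellFounded_gt (α := Path s t)).induction with
  | _ b ih =>
    obtain ⟨ρ, hρ, hρb, hρc⟩ := hb
    -- The value 0 at branches that are not pivots above `b` only makes the choice total.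
    have hex : ∀ c : Path s t, ∃ σ ∈ relationSpace I s t, (b < c ∧ IsPivot I c →
        σ c = 1 ∧ (∀ d < c, σ d = 0) ∧ ∀ d, d ≠ c → IsPivot I d → σ d = 0) := by
      intro c
      by_cases hc : b < c ∧ IsPivot I c
      · obtain ⟨σ, h1, h2⟩ := ih c hc.1 hc.2
        exact ⟨σ, h1, fun _ => h2⟩
      · exact ⟨0, zero_mem _, fun h => absurd h hc⟩
    choose σ hσR hσ using hex
    let S := Finset.univ.filter fun c : Path s t => b < c ∧ IsPivot I c
    let τ := (ρ b)⁻¹ • ρ - ∑ c ∈ S, ((ρ b)⁻¹ * ρ c) • σ c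
    have hτ : ∀ d, τ d = (ρ b)⁻¹ * ρ d - ∑ c ∈ S, (ρ b)⁻¹ * ρ c * σ c d := by
      intro d
      simp [τ]
    have hle : ∀ d, d ≤ b → ∑ c ∈ S, (ρ b)⁻¹ * ρ c * σ c d = 0 := by
      intro d hd
      refine Finset.sum_eq_zero fun c hc => ?_
      have hc := (Finset.mem_filter.1 hc).2
      rw [(hσ c hc).2.1 d (hd.trans_lt hc.1), mul_zero]
    refine ⟨τ, ?_, ?_, fun c hc => ?_, fun c hcb hc => ?_⟩
    · exact sub_mem (Submodule.smul_mem _ _ hρ)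
        (Submodule.sum_mem _ fun c _ => Submodule.smul_mem _ _ (hσR c))
    · rw [hτ, hle b le_rfl, sub_zero, inv_mul_cancel₀ hρb]
    · rw [hτ, hle c hc.le, sub_zero, hρc c hc, mul_zero]
    · rcases lt_or_gt_of_ne hcb with h | h
      · rw [hτ, hle c h.le, sub_zero, hρc c h, mul_zero]
      · rw [hτ, Finset.sum_eq_single c]
        · rw [(hσ c ⟨h, hc⟩).1, mul_one, sub_self]
        · intro d hd hdc
          rw [(hσ d (Finset.mem_filter.1 hd).2).2.2 c hdc.symm hc, mul_zero]
        · intro hcS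
          exact absurd (Finset.mem_filter.2 ⟨Finset.mem_univ c, h, hc⟩) hcS

/-- The reduced relations span the space of relations. -/
theorem relationSpace_le_of_reduced [Finite (Path s t)] {N : Submodule k (Path s t →₀ k)}
    (h : ∀ ρ, IsReducedRelation I ρ → ρ ∈ N) : relationSpace I s t ≤ N := by
  classical
  cases nonempty_fintype (Path s t)
  intro ρ hρ
  have hex : ∀ c : Path s t, ∃ σ ∈ relationSpace I s t, σ ∈ N ∧ (IsPivot I c →
      σ c = 1 ∧ ∀ d, d ≠ c → IsPivot I d → σ d = 0) := by
    intro c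
    by_cases hc : IsPivot I c
    · obtain ⟨σ, h1, h2, h3, h4⟩ := hc.exists_reduced
      exact ⟨σ, h1, h σ ⟨h1, c, h2, h3, h4⟩, fun _ => ⟨h2, h4⟩⟩
    · exact ⟨0, zero_mem _, zero_mem _, fun h => absurd h hc⟩
  choose σ hσR hσN hσ using hex
  -- A relation is the combination of the reduced rows whose coefficients are its values at the
  -- pivots: the difference vanishes at every pivot.
  have key : ρ - ∑ c ∈ Finset.univ.filter (fun c => IsPivot I c), ρ c • σ c = 0 := by
    refine eq_zero_of_pivots (I := I) (sub_mem hρ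
      (Submodule.sum_mem _ fun c _ => Submodule.smul_mem _ _ (hσR c))) fun b hb => ?_
    rw [Finsupp.sub_apply, Finsupp.finsetSum_apply, Finset.sum_eq_single b]
    · simp [(hσ b hb).1]
    · intro c hc hcb
      rw [Finsupp.smul_apply, (hσ c (Finset.mem_filter.1 hc).2).2 b hcb.symm hb, smul_zero]
    · intro hb'
      exact absurd (Finset.mem_filter.2 ⟨Finset.mem_univ b, hb⟩) hb'
  rw [sub_eq_zero.1 key]
  exact Submodule.sum_mem _ fun c _ => Submodule.smul_mem _ _ (hσN c)

/-- If `d` is the pivot of `ρ`, the scaled row minus `l d • ρ` is a relation: it cancels at `d` and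
vanishes at the other pivots because `ρ` does. Hence it is zero, and `l` equals `l d` on the support
of `ρ`. -/
theorem IsReducedRelation.eq_of_scaleBranches {l : Path s t → k}
    (hl : ∀ ρ ∈ relationSpace I s t, scaleBranches l ρ ∈ relationSpace I s t)
    {ρ : Path s t →₀ k} (hρ : IsReducedRelation I ρ) {b c : Path s t} (hb : ρ b ≠ 0)
    (hc : ρ c ≠ 0) : l b = l c := by
  obtain ⟨hρ, d, hd, -, hpiv⟩ := hρ
  have key : scaleBranches l ρ - l d • ρ = 0 := by
    refine eq_zero_of_pivots (I := I) (sub_mem (hl ρ hρ) (Submodule.smul_mem _ _ hρ))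
      fun e he => ?_
    rw [Finsupp.sub_apply, scaleBranches_apply, Finsupp.smul_apply, smul_eq_mul]
    by_cases hed : e = d
    · rw [hed, sub_self]
    · rw [hpiv e hed he, mul_zero, mul_zero, sub_self]
  have h : ∀ e, ρ e ≠ 0 → l e = l d := by
    intro e he
    have h1 := DFunLike.congr_fun key e
    rw [Finsupp.sub_apply, scaleBranches_apply, Finsupp.smul_apply, smul_eq_mul, ← sub_mul] at h1
    exact sub_eq_zero.1 ((mul_eq_zero.1 h1).resolve_right he)
  rw [h b hb, h c hc]

/-- A branch containing a monomial relation lies in `I` itself, so it is a pivot and its row has a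
single term. Such branches therefore impose no condition on weights. -/
theorem IsReducedRelation.eq_of_containsMonomialRelation [I.IsTwoSided] {ρ : Path s t →₀ k}
    (hρ : IsReducedRelation I ρ) {b c : Path s t} (hbm : ContainsMonomialRelation I b)
    (hb : ρ b ≠ 0) (hc : ρ c ≠ 0) : b = c := by
  classical
  obtain ⟨hρ, d, hd, -, hpiv⟩ := hρ
  have hbR := single_mem_relationSpace hbm
  have hbp : IsPivot I b := ⟨_, hbR, by simp, fun e he => Finsupp.single_eq_of_ne he.ne⟩
  obtain rfl : b = d := by
    by_contra h
    exact hb (hpiv b h hbp)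
  have key : ρ - Finsupp.single b 1 = 0 := by
    refine eq_zero_of_pivots (I := I) (sub_mem hρ hbR) fun e he => ?_
    by_cases heb : e = b
    · rw [heb, Finsupp.sub_apply, hd, Finsupp.single_eq_same, sub_self]
    · rw [Finsupp.sub_apply, hpiv e heb he, Finsupp.single_eq_of_ne heb, sub_self]
  by_contra h
  rw [sub_eq_zero.1 key] at hc
  exact hc (Finsupp.single_eq_of_ne' h)

/-- It suffices to treat reduced rows. A row with several terms involves only pairwise adjacent
vertices of the graph, so scaling multiplies each row by the value of `l` at its pivot. -/
theorem IsAdmissible.scaleBranches_mem [Finite (Path s t)] [I.IsTwoSided] (hI : IsAdmissible I)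
    {l : Path s t → k} (hl : ∀ b c, (relationGraph I s t).Adj b c → l b.1 = l c.1)
    {ρ : Path s t →₀ k} (hρ : ρ ∈ relationSpace I s t) :
    scaleBranches l ρ ∈ relationSpace I s t := by
  suffices h : relationSpace I s t ≤ (relationSpace I s t).comap (scaleBranches l) from h hρ
  refine relationSpace_le_of_reduced fun ρ hρ => ?_
  obtain ⟨d, hd, -⟩ := hρ.2
  have hd0 : ρ d ≠ 0 := by rw [hd]; exact one_ne_zero
  have h : scaleBranches l ρ = l d • ρ := by
    ext e
    rw [scaleBranches_apply, Finsupp.smul_apply, smul_eq_mul]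
    by_cases he : ρ e = 0
    · rw [he, mul_zero, mul_zero]
    congr 1
    by_cases hde : d = e
    · rw [hde]
    · have hdm : ¬ ContainsMonomialRelation I d := fun h =>
        hde (hρ.eq_of_containsMonomialRelation h hd0 he)
      have hem : ¬ ContainsMonomialRelation I e := fun h =>
        hde (hρ.eq_of_containsMonomialRelation h he hd0).symm
      exact (hl ⟨d, hI.two_le_length hρ.1 hd0, hdm⟩ ⟨e, hI.two_le_length hρ.1 he, hem⟩
        ⟨fun h => hde (congrArg Subtype.val h), ρ, hρ, hd0, he⟩).symm
  rw [Submodule.mem_comap, h]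
  exact Submodule.smul_mem _ _ hρ.1

end Relations

end ToupieAlg

namespace ToupieAlg

/-! ### Hochschild cocycles -/

section Cocycles

attribute [local instance 100] LieRing.ofAssociativeRing

variable {k : Type u} [Field k] {A : Type v} [Ring A] [Algebra k A]

theorem hochschildD0_apply (a x : A) : hochschildD0 k A a x = x * a - a * x := rfl

theorem mem_hochschildZ1 {f : Module.End k A} :
    f ∈ hochschildZ1 k A ↔ ∀ x y, f (x * y) = x * f y + f x * y :=
  mem_ker_hochschildD1 k A f

theorem hochschildD0_mem_hochschildZ1 (a : A) : hochschildD0 k A a ∈ hochschildZ1 k A := by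
  refine mem_hochschildZ1.2 fun x y => ?_
  simp only [hochschildD0_apply, mul_sub, sub_mul, mul_assoc]
  abel

theorem mem_hochschildB1 {f : hochschildZ1 k A} :
    f ∈ hochschildB1 k A ↔ ∃ a, hochschildD0 k A a = f.1 := Iff.rfl

theorem isLieAbelian_HH1_iff :
    IsLieAbelian (HH1 k A) ↔ ∀ f g : hochschildZ1 k A, ⁅f, g⁆ ∈ hochschildB1 k A := by
  constructor
  · intro h f g
    rw [← LieSubmodule.Quotient.mk_eq_zero', LieSubmodule.Quotient.mk_bracket]
    exact trivial_lie_zero _ _ _ _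
  · intro h
    refine ⟨fun x y => ?_⟩
    obtain ⟨f, rfl⟩ := LieSubmodule.Quotient.surjective_mk' _ x
    obtain ⟨g, rfl⟩ := LieSubmodule.Quotient.surjective_mk' _ y
    exact LieSubmodule.Quotient.mk_eq_zero'.2 (h f g)

theorem hochschildZ1_lie_apply (f g : hochschildZ1 k A) (x : A) :
    (⁅f, g⁆ : hochschildZ1 k A).1 x = f.1 (g.1 x) - g.1 (f.1 x) := rfl

end Cocycles

/-! ### Calculus in quotients of path algebras -/

section Quotient

attribute [local instance 100] LieRing.ofAssociativeRing

variable {k : Type u} [Field k] {V : Type v} [Fintype V] [Quiver.{w} V]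
  (I : Ideal (PathAlgebra k V)) [I.IsTwoSided]

/-- The class of a path modulo an ideal. -/
noncomputable def pathClass {x y : V} (p : Path x y) : PathAlgebra k V ⧸ I :=
  Ideal.Quotient.mk I (PathAlgebra.ofPath k p)

/-- The class of the idempotent of a vertex modulo an ideal. -/
noncomputable def vertexClass (x : V) : PathAlgebra k V ⧸ I :=
  Ideal.Quotient.mk I (PathAlgebra.vertex k x)

variable {I}

theorem pathClass_nil (x : V) : pathClass I (Path.nil : Path x x) = vertexClass I x := rfl

theorem pathClass_mul {x y z : V} (p : Path x y) (q : Path y z) :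
    pathClass I p * pathClass I q = pathClass I (p.comp q) := by
  rw [pathClass, pathClass, ← map_mul, PathAlgebra.ofPath_mul_ofPath]; rfl

theorem pathClass_mul_of_ne {x y y' z : V} (h : y ≠ y') (p : Path x y) (q : Path y' z) :
    pathClass I p * pathClass I q = 0 := by
  rw [pathClass, pathClass, ← map_mul, PathAlgebra.ofPath_mul_ofPath_of_ne h, map_zero]

theorem vertexClass_mul_pathClass {x y : V} (p : Path x y) :
    vertexClass I x * pathClass I p = pathClass I p := by
  rw [← pathClass_nil, pathClass_mul, Path.nil_comp]

theorem pathClass_mul_vertexClass {x y : V} (p : Path x y) :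
    pathClass I p * vertexClass I y = pathClass I p := by
  rw [← pathClass_nil, pathClass_mul, Path.comp_nil]

theorem vertexClass_mul_self (x : V) :
    vertexClass I x * vertexClass I x = vertexClass I x :=
  vertexClass_mul_pathClass Path.nil

theorem vertexClass_mul_of_ne {x y : V} (h : x ≠ y) :
    vertexClass I x * vertexClass I y = 0 :=
  pathClass_mul_of_ne h _ _

theorem sum_vertexClass : ∑ x : V, vertexClass I x = 1 := by
  simp only [vertexClass]
  rw [← map_sum, ← PathAlgebra.one_def, map_one]

theorem quotient_hom_ext {M : Type*} [AddCommGroup M] [Module k M]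
    {f g : (PathAlgebra k V ⧸ I) →ₗ[k] M}
    (h : ∀ (x y : V) (p : Path x y), f (pathClass I p) = g (pathClass I p)) : f = g := by
  have h' : f ∘ₗ (Ideal.Quotient.mkₐ k I).toLinearMap = g ∘ₗ (Ideal.Quotient.mkₐ k I).toLinearMap :=
    PathAlgebra.hom_ext fun ⟨x, y, p⟩ => h x y p
  refine LinearMap.ext fun u => ?_
  obtain ⟨u, rfl⟩ := Ideal.Quotient.mkₐ_surjective k I u
  exact DFunLike.congr_fun h' u

theorem corner_mem_span (u : PathAlgebra k V ⧸ I) (x y : V) :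
    vertexClass I x * u * vertexClass I y ∈
      Submodule.span k (Set.range fun p : Path x y => pathClass I p) := by
  obtain ⟨f, rfl⟩ := Ideal.Quotient.mkₐ_surjective k I u
  have h := Submodule.mem_map_of_mem (f := (Ideal.Quotient.mkₐ k I).toLinearMap)
    (PathAlgebra.vertex_mul_mul_vertex_mem f x y)
  rw [Submodule.map_span, ← Set.range_comp] at h
  rw [AlgHom.toLinearMap_apply, map_mul, map_mul] at h
  exact h

/-- A linear map vanishing on the ideal induces a linear map on the quotient algebra. -/
theorem exists_quotient_lift {M : Type*} [AddCommGroup M] [Module k M]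
    (d : PathAlgebra k V →ₗ[k] M) (hd : ∀ f ∈ I, d f = 0) :
    ∃ F : (PathAlgebra k V ⧸ I) →ₗ[k] M, ∀ f, F (Ideal.Quotient.mk I f) = d f := by
  let π := (Ideal.Quotient.mkₐ k I).toLinearMap
  have hπ : Function.Surjective π := Ideal.Quotient.mkₐ_surjective k I
  have hker : LinearMap.ker π ≤ LinearMap.ker d := fun f hf =>
    hd f (Ideal.Quotient.eq_zero_iff_mem.1 hf)
  refine ⟨(Submodule.liftQ _ d hker) ∘ₗ (π.quotKerEquivOfSurjective hπ).symm.toLinearMap,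
    fun f => ?_⟩
  have h : (π.quotKerEquivOfSurjective hπ).symm (π f) = Submodule.Quotient.mk f :=
    (LinearEquiv.symm_apply_eq _).2 rfl
  change Submodule.liftQ _ d hker ((π.quotKerEquivOfSurjective hπ).symm (π f)) = d f
  rw [h, Submodule.liftQ_apply]

/-- A linear map satisfying the Leibniz rule on paths and vanishing on the ideal induces a
Hochschild cocycle. -/
theorem exists_cocycle (d : PathAlgebra k V →ₗ[k] PathAlgebra k V ⧸ I) (hd : ∀ f ∈ I, d f = 0)
    (hmul : ∀ (x y z : V) (p : Path x y) (q : Path y z), d (PathAlgebra.ofPath k (p.comp q)) =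
      pathClass I p * d (PathAlgebra.ofPath k q) + d (PathAlgebra.ofPath k p) * pathClass I q)
    (hne : ∀ (x y y' z : V) (p : Path x y) (q : Path y' z), y ≠ y' →
      pathClass I p * d (PathAlgebra.ofPath k q) + d (PathAlgebra.ofPath k p) * pathClass I q = 0) :
    ∃ F ∈ hochschildZ1 k (PathAlgebra k V ⧸ I), ∀ f, F (Ideal.Quotient.mk I f) = d f := by
  obtain ⟨F, hF⟩ := exists_quotient_lift d hd
  refine ⟨F, mem_hochschildZ1.2 fun u v => ?_, hF⟩
  obtain ⟨f, rfl⟩ := Ideal.Quotient.mk_surjective u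
  obtain ⟨g, rfl⟩ := Ideal.Quotient.mk_surjective v
  have hsmul : ∀ (c : k) (f : PathAlgebra k V),
    Ideal.Quotient.mk I (c • f) = c • Ideal.Quotient.mk I f := fun _ _ => rfl
  induction f using PathAlgebra.induction with
  | zero => simp
  | add f₁ f₂ h₁ h₂ => simp only [map_add, add_mul, h₁, h₂]; abel
  | smul c p =>
    induction g using PathAlgebra.induction with
    | zero => simp
    | add g₁ g₂ h₁ h₂ => simp only [map_add, mul_add, h₁, h₂]; abel
    | smul e q =>
      simp only [hsmul, map_smul, smul_mul_assoc, mul_smul_comm, ← smul_add]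
      congr 2
      rw [← map_mul, hF, hF, hF, PathAlgebra.single_mul_single]
      obtain ⟨x, y, p⟩ := p
      obtain ⟨y', z, q⟩ := q
      by_cases h : y = y'
      · subst h
        rw [PathAlgebra.mulPath_of_eq]
        exact hmul x y z p q
      · rw [PathAlgebra.mulPath_of_ne h, map_zero]
        exact (hne x y y' z p q h).symm

/-- Every cocycle differs by a coboundary from one that vanishes on the idempotents. -/
theorem exists_sub_coboundary_vertexClass_eq_zero {f : Module.End k (PathAlgebra k V ⧸ I)}
    (hf : f ∈ hochschildZ1 k (PathAlgebra k V ⧸ I)) :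
    ∃ a, ∀ x, (f - hochschildD0 k (PathAlgebra k V ⧸ I) a) (vertexClass I x) = 0 := by
  classical
  have hf := mem_hochschildZ1.1 hf
  have h0 : ∀ x, vertexClass I x * f (vertexClass I x) * vertexClass I x = 0 := by
    intro x
    have h := congrArg (vertexClass I x * ·) (hf (vertexClass I x) (vertexClass I x))
    simp only [vertexClass_mul_self, mul_add, ← mul_assoc] at h
    exact left_eq_add.1 h
  have h1 : ∀ x y, x ≠ y → f (vertexClass I x) * vertexClass I y =
      -(vertexClass I x * f (vertexClass I y)) := by
    intro x y hxy
    have h := hf (vertexClass I x) (vertexClass I y)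
    rw [vertexClass_mul_of_ne hxy, map_zero] at h
    exact eq_neg_of_add_eq_zero_right h.symm
  -- For `a = ∑ e_y f(e_y)`, one has `e_x a = e_x f(e_x)`, while `h0` and `h1` turn `a e_x` into
  -- `e_x f(e_x) - f(e_x)`. The difference is `f(e_x)`.
  refine ⟨∑ y, vertexClass I y * f (vertexClass I y), fun x => ?_⟩
  rw [LinearMap.sub_apply, hochschildD0_apply, Finset.mul_sum, Finset.sum_mul,
    Finset.sum_eq_single x, ← mul_assoc, vertexClass_mul_self]
  · have h2 : ∑ y, vertexClass I y * f (vertexClass I y) * vertexClass I x =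
        vertexClass I x * f (vertexClass I x) - f (vertexClass I x) := by
      have h3 : ∀ y, vertexClass I y * f (vertexClass I y) * vertexClass I x =
          (if y = x then vertexClass I x * f (vertexClass I x) else 0) -
            vertexClass I y * f (vertexClass I x) := by
        intro y
        by_cases hyx : y = x
        · subst hyx
          rw [h0, if_pos rfl, sub_self]
        · rw [if_neg hyx, mul_assoc, h1 y x hyx, mul_neg, ← mul_assoc, vertexClass_mul_self,
            zero_sub]
      rw [Finset.sum_congr rfl fun y _ => h3 y, Finset.sum_sub_distrib, ← Finset.sum_mul,
        sum_vertexClass, one_mul, Finset.sum_ite_eq' Finset.univ x, if_pos (Finset.mem_univ x)]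
    rw [h2]
    abel
  · intro y _ hyx
    rw [← mul_assoc, vertexClass_mul_of_ne hyx.symm, zero_mul]
  · intro h
    exact absurd (Finset.mem_univ x) h

/-- A cocycle that vanishes on the idempotents and is diagonal on the arrows is diagonal on the
paths. -/
theorem map_pathClass_of_diagonal {f : Module.End k (PathAlgebra k V ⧸ I)}
    (hf : f ∈ hochschildZ1 k (PathAlgebra k V ⧸ I)) (h0 : ∀ x, f (vertexClass I x) = 0)
    {c : ∀ x y : V, (x ⟶ y) → k}
    (hc : ∀ (x y : V) (e : x ⟶ y), f (pathClass I e.toPath) = c x y e • pathClass I e.toPath)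
    {x y : V} (p : Path x y) : f (pathClass I p) = pathWeight c p • pathClass I p := by
  induction p with
  | nil => rw [pathClass_nil, h0, pathWeight_nil, zero_smul]
  | cons p e ih =>
    have h : pathClass I (p.cons e) = pathClass I p * pathClass I e.toPath :=
      (pathClass_mul p e.toPath).symm
    rw [h, mem_hochschildZ1.1 hf, ih, hc, mul_smul_comm, smul_mul_assoc, ← add_smul,
      pathWeight_cons, add_comm]

/-- The arrows span the corners of the quotient algebra in which they lie. -/
def ArrowsSpanCorners (I : Ideal (PathAlgebra k V)) [I.IsTwoSided] : Prop :=
  ∀ (x y : V) (e : x ⟶ y) (u : PathAlgebra k V ⧸ I),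
    ∃ c : k, vertexClass I x * u * vertexClass I y = c • pathClass I e.toPath

/-- A derivation that kills the idempotents commutes with multiplication by them on either side. -/
theorem cocycle_mem_corner {f : Module.End k (PathAlgebra k V ⧸ I)}
    (hf : f ∈ hochschildZ1 k (PathAlgebra k V ⧸ I)) (h0 : ∀ x, f (vertexClass I x) = 0)
    {x y : V} (p : Path x y) :
    f (pathClass I p) = vertexClass I x * f (pathClass I p) * vertexClass I y := by
  have hf := mem_hochschildZ1.1 hf
  conv_lhs => rw [← vertexClass_mul_pathClass p, ← pathClass_mul_vertexClass p]
  rw [hf, hf, h0, h0, zero_mul, mul_zero, zero_add, add_zero, mul_assoc]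

theorem ArrowsSpanCorners.exists_diagonal (hA : ArrowsSpanCorners I)
    {f : Module.End k (PathAlgebra k V ⧸ I)} (hf : f ∈ hochschildZ1 k (PathAlgebra k V ⧸ I)) :
    ∃ (a : PathAlgebra k V ⧸ I) (c : ∀ x y : V, (x ⟶ y) → k), ∀ (x y : V) (p : Path x y),
      (f - hochschildD0 k _ a) (pathClass I p) = pathWeight c p • pathClass I p := by
  obtain ⟨a, ha⟩ := exists_sub_coboundary_vertexClass_eq_zero hf
  have hg : f - hochschildD0 k _ a ∈ hochschildZ1 k (PathAlgebra k V ⧸ I) :=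
    sub_mem hf (hochschildD0_mem_hochschildZ1 a)
  choose c hc using fun x y e => hA x y e ((f - hochschildD0 k _ a) (pathClass I e.toPath))
  exact ⟨a, c, fun x y p => map_pathClass_of_diagonal hg ha (fun x y e =>
    (cocycle_mem_corner hg ha _).trans (hc x y e)) p⟩

/-- Modulo the ideal of coboundaries both cocycles can be made diagonal in the same spanning set of
paths, and diagonal operators commute. -/
theorem ArrowsSpanCorners.isLieAbelian (hA : ArrowsSpanCorners I) :
    IsLieAbelian (HH1 k (PathAlgebra k V ⧸ I)) := by
  refine isLieAbelian_HH1_iff.2 fun f g => ?_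
  obtain ⟨a, c, hf⟩ := hA.exists_diagonal f.2
  obtain ⟨b, d, hg⟩ := hA.exists_diagonal g.2
  let a' : hochschildZ1 k (PathAlgebra k V ⧸ I) := ⟨_, hochschildD0_mem_hochschildZ1 a⟩
  let b' : hochschildZ1 k (PathAlgebra k V ⧸ I) := ⟨_, hochschildD0_mem_hochschildZ1 b⟩
  have ha : a' ∈ hochschildB1 k (PathAlgebra k V ⧸ I) := ⟨a, rfl⟩
  have hb : b' ∈ hochschildB1 k (PathAlgebra k V ⧸ I) := ⟨b, rfl⟩
  have h0 : ⁅f - a', g - b'⁆ = 0 := by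
    refine Subtype.ext (quotient_hom_ext fun x y p => ?_)
    rw [hochschildZ1_lie_apply]
    change (f.1 - hochschildD0 k _ a) ((g.1 - hochschildD0 k _ b) (pathClass I p)) -
      (g.1 - hochschildD0 k _ b) ((f.1 - hochschildD0 k _ a) (pathClass I p)) = 0
    rw [hf, hg, map_smul, map_smul, hf, hg, smul_comm, sub_self]
  have h1 : ⁅f, g⁆ = ⁅f - a', g - b'⁆ + ⁅f - a', b'⁆ + ⁅a', g⁆ := by
    simp only [sub_lie, lie_sub]
    abel
  rw [h1, h0, zero_add]
  exact add_mem (lie_mem_right k _ _ _ _ hb) (lie_mem_left k _ _ _ _ ha)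

end Quotient

/-! ### The corner spanned by the branches -/

section Corner

attribute [local instance 100] LieRing.ofAssociativeRing

variable {k : Type u} [Field k] {V : Type v} [Fintype V] [Quiver.{w} V] {s t : V}
  {I : Ideal (PathAlgebra k V)} [I.IsTwoSided]

variable (I) in
/-- The corner `e_x A e_y`. -/
noncomputable def corner (x y : V) : Submodule k (PathAlgebra k V ⧸ I) :=
  LinearMap.range (LinearMap.mulLeftRight k (vertexClass I x, vertexClass I y))

theorem mem_corner {x y : V} {u : PathAlgebra k V ⧸ I} :
    u ∈ corner I x y ↔ ∃ v, vertexClass I x * v * vertexClass I y = u := Iff.rfl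

theorem pathClass_mem_corner {x y : V} (p : Path x y) : pathClass I p ∈ corner I x y :=
  ⟨pathClass I p, by
    change vertexClass I x * pathClass I p * vertexClass I y = _
    rw [vertexClass_mul_pathClass, pathClass_mul_vertexClass]⟩

theorem vertexClass_mul_of_mem_corner {x y : V} {u : PathAlgebra k V ⧸ I} (hu : u ∈ corner I x y) :
    vertexClass I x * u = u := by
  obtain ⟨v, rfl⟩ := mem_corner.1 hu
  rw [← mul_assoc, ← mul_assoc, vertexClass_mul_self]

theorem mul_vertexClass_of_mem_corner {x y : V} {u : PathAlgebra k V ⧸ I} (hu : u ∈ corner I x y) :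
    u * vertexClass I y = u := by
  obtain ⟨v, rfl⟩ := mem_corner.1 hu
  rw [mul_assoc, vertexClass_mul_self]

theorem corner_le_span (x y : V) :
    corner I x y ≤ Submodule.span k (Set.range fun p : Path x y => pathClass I p) := by
  intro u hu
  obtain ⟨v, rfl⟩ := mem_corner.1 hu
  exact corner_mem_span v x y

theorem finrank_corner : Module.finrank k (corner I s t) = cornerDim I s t := rfl

theorem finite_corner (x y : V) [Finite (Path x y)] : Module.Finite k (corner I x y) := by
  have := Module.Finite.span_of_finite k (Set.finite_range fun p : Path x y => pathClass I p)
  exact Submodule.finiteDimensional_of_le (corner_le_span x y)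

theorem IsAdmissible.pathClass_toPath_ne_zero (hI : IsAdmissible I) {x y : V} (e : x ⟶ y) :
    pathClass I e.toPath ≠ 0 := by
  intro h
  have h1 := hI.coeff_eq_zero (Ideal.Quotient.eq_zero_iff_mem.1 h)
    (p := ⟨x, y, e.toPath⟩) (by simp)
  rw [PathAlgebra.coeff_ofPath_self] at h1
  exact one_ne_zero h1

theorem IsToupie.corner_self (hQ : IsToupie s t) (x : V) (u : PathAlgebra k V ⧸ I) :
    ∃ c : k, vertexClass I x * u * vertexClass I x = c • vertexClass I x := by
  have h : (Set.range fun p : Path x x => pathClass I p) = {vertexClass I x} := by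
    ext v
    constructor
    · rintro ⟨p, rfl⟩
      rw [Set.mem_singleton_iff]
      exact congrArg _ (hQ.eq_nil p)
    · rintro rfl
      exact ⟨Path.nil, rfl⟩
  have h1 := corner_mem_span u x x
  rw [h] at h1
  obtain ⟨c, hc⟩ := Submodule.mem_span_singleton.1 h1
  exact ⟨c, hc.symm⟩

/-- Away from the corner of the branches, an arrow is the only path between its ends. In that corner
there is either no arrow, or a nonzero arrow in a space of dimension at most one. -/
theorem IsToupie.arrowsSpanCorners [∀ x y : V, Finite (x ⟶ y)] (hQ : IsToupie s t)
    (hI : IsAdmissible I) (h : numArrows s t = 0 ∨ cornerDim I s t ≤ 1) : ArrowsSpanCorners I := by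
  intro x y e u
  by_cases hxy : x = s ∧ y = t
  · obtain ⟨rfl, rfl⟩ := hxy
    have := hQ.finite_branches
    have := finite_corner (I := I) x y
    rcases h with h | h
    · rw [numArrows, Finite.card_eq_zero_iff] at h
      exact (h.false e).elim
    · rw [← finrank_corner] at h
      obtain ⟨v, hv⟩ := finrank_le_one_iff.1 h
      obtain ⟨c, hc⟩ := hv ⟨_, pathClass_mem_corner e.toPath⟩
      obtain ⟨d, hd⟩ := hv ⟨vertexClass I x * u * vertexClass I y, u, rfl⟩
      have hc : c • v.1 = pathClass I e.toPath := congrArg Subtype.val hc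
      have hd : d • v.1 = vertexClass I x * u * vertexClass I y := congrArg Subtype.val hd
      have hc0 : c ≠ 0 := by
        rintro rfl
        refine hI.pathClass_toPath_ne_zero e ?_
        rw [← hc]
        exact zero_smul _ _
      refine ⟨d * c⁻¹, ?_⟩
      rw [← hc, ← hd, smul_smul, mul_assoc, inv_mul_cancel₀ hc0, mul_one]
  · have := hQ.subsingleton_path hxy
    have h1 := corner_mem_span u x y
    have h2 : (Set.range fun p : Path x y => pathClass I p) ⊆ {pathClass I e.toPath} := by
      rintro _ ⟨p, rfl⟩
      rw [Subsingleton.elim p e.toPath]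
      rfl
    obtain ⟨c, hc⟩ := Submodule.mem_span_singleton.1 (Submodule.span_mono h2 h1)
    exact ⟨c, hc.symm⟩

/-- The cocycle that maps an arrow from the source to the sink to a given element of the corner,
and all other paths to zero. -/
theorem IsToupie.exists_arrow_cocycle (hQ : IsToupie s t) (hI : IsAdmissible I) (e : s ⟶ t) :
    ∃ χ : (PathAlgebra k V ⧸ I) →ₗ[k] k, χ (pathClass I e.toPath) = 1 ∧
      ∀ w ∈ corner I s t, χ.smulRight w ∈ hochschildZ1 k (PathAlgebra k V ⧸ I) := by
  obtain ⟨χ, hχ⟩ := exists_quotient_lift (I := I) (PathAlgebra.coeff k ⟨s, t, e.toPath⟩)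
    (fun f hf => hI.coeff_eq_zero hf (by simp))
  refine ⟨χ, (hχ _).trans (PathAlgebra.coeff_ofPath_self _), fun w hw => ?_⟩
  have h0 : ∀ {x y : V} (p : Path x y), ¬ (x = s ∧ y = t) →
      PathAlgebra.coeff k ⟨s, t, e.toPath⟩ (PathAlgebra.ofPath k p) = 0 := by
    intro x y p hxy
    refine PathAlgebra.coeff_single_of_ne fun h => hxy ?_
    obtain ⟨rfl, h⟩ := Sigma.mk.inj_iff.1 h
    exact ⟨rfl, (Sigma.mk.inj_iff.1 (eq_of_heq h)).1⟩
  have hl : ∀ {x y : V} (p : Path x y), y ≠ s → pathClass I p * w = 0 := by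
    intro x y p hy
    rw [← vertexClass_mul_of_mem_corner hw, ← mul_assoc, ← pathClass_nil,
      pathClass_mul_of_ne hy, zero_mul]
  have hr : ∀ {x y : V} (p : Path x y), x ≠ t → w * pathClass I p = 0 := by
    intro x y p hx
    rw [← mul_vertexClass_of_mem_corner hw, mul_assoc, ← pathClass_nil,
      pathClass_mul_of_ne hx.symm, mul_zero]
  -- The Leibniz rule holds because an arrow is not a product of two paths of positive length, and
  -- `w` is annihilated by every path of positive length on either side.
  obtain ⟨F, hF, hFd⟩ := exists_cocycle (I := I)
    ((PathAlgebra.coeff k ⟨s, t, e.toPath⟩).smulRight w)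
    (fun f hf => by
      rw [LinearMap.smulRight_apply, hI.coeff_eq_zero hf (by simp), zero_smul])
    (fun x y z p q => by
      simp only [LinearMap.smulRight_apply, mul_smul_comm, smul_mul_assoc]
      by_cases hy : y = s
      · subst hy
        obtain rfl := hQ.eq_source_of_path p
        rw [hQ.eq_nil p, Path.nil_comp, pathClass_nil, vertexClass_mul_of_mem_corner hw,
          h0 Path.nil fun h => hQ.source_ne_sink h.2, zero_smul, add_zero]
      · rw [h0 q fun h => hy h.1, zero_smul, zero_add]
        by_cases hyt : y = t
        · subst hyt
          obtain rfl := hQ.eq_sink_of_path q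
          rw [hQ.eq_nil q, Path.comp_nil, pathClass_nil, mul_vertexClass_of_mem_corner hw]
        · rw [hr q hyt, smul_zero]
          by_cases hxz : x = s ∧ z = t
          · obtain ⟨rfl, rfl⟩ := hxz
            have hpq : p.comp q ≠ e.toPath := by
              intro h
              have h1 := congrArg Path.length h
              rw [Path.length_comp, Hom.toPath, Path.length_cons, Path.length_nil] at h1
              have hp : p.length ≠ 0 := fun h => hy (Path.eq_of_length_zero p h).symm
              have hq : q.length ≠ 0 := fun h => hyt (Path.eq_of_length_zero q h)
              omega
            rw [PathAlgebra.coeff_ofPath_of_ne hpq, zero_smul]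
          · rw [h0 _ hxz, zero_smul])
    (fun x y y' z p q hy => by
      simp only [LinearMap.smulRight_apply, mul_smul_comm, smul_mul_assoc]
      have h1 : PathAlgebra.coeff k ⟨s, t, e.toPath⟩ (PathAlgebra.ofPath k q) •
          (pathClass I p * w) = 0 := by
        by_cases h : y = s
        · rw [h0 q fun h' => hy (h.trans h'.1.symm), zero_smul]
        · rw [hl p h, smul_zero]
      have h2 : PathAlgebra.coeff k ⟨s, t, e.toPath⟩ (PathAlgebra.ofPath k p) •
          (w * pathClass I q) = 0 := by
        by_cases h : y' = t
        · rw [h0 p fun h' => hy (h'.2.trans h.symm), zero_smul]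
        · rw [hr q h, smul_zero]
      rw [h1, h2, add_zero])
  have hχF : χ.smulRight w = F := by
    refine LinearMap.ext fun u => ?_
    obtain ⟨f, rfl⟩ := Ideal.Quotient.mk_surjective u
    rw [hFd, LinearMap.smulRight_apply, LinearMap.smulRight_apply, hχ]
  rw [hχF]
  exact hF

/-- Coboundaries are diagonal on the arrows from the source to the sink. -/
theorem IsToupie.coboundary_toPath (hQ : IsToupie s t) (e : s ⟶ t) (a : PathAlgebra k V ⧸ I) :
    ∃ c : k, vertexClass I s * hochschildD0 k _ a (pathClass I e.toPath) * vertexClass I t =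
      c • pathClass I e.toPath := by
  obtain ⟨c, hc⟩ := hQ.corner_self t a
  obtain ⟨d, hd⟩ := hQ.corner_self s a
  refine ⟨c - d, ?_⟩
  rw [hochschildD0_apply, mul_sub, sub_mul, sub_smul, ← mul_assoc, vertexClass_mul_pathClass,
    mul_assoc, mul_assoc, mul_assoc, pathClass_mul_vertexClass, ← pathClass_mul_vertexClass e.toPath,
    mul_assoc, ← mul_assoc (vertexClass I t), hc, ← vertexClass_mul_pathClass e.toPath]
  congr 1
  · rw [mul_smul_comm]
  · rw [mul_assoc (vertexClass I s) (pathClass I e.toPath), pathClass_mul_vertexClass, ← mul_assoc,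
      ← mul_assoc, hd, smul_mul_assoc, vertexClass_mul_pathClass]

/-- For `w` in the corner but not a multiple of the arrow `e`, the bracket of the cocycles sending
`e` to `e` and to `w` maps `e` to `χ(w) e - w`. A coboundary would give a multiple of `e` here. -/
theorem IsToupie.not_isLieAbelian [∀ x y : V, Finite (x ⟶ y)] (hQ : IsToupie s t)
    (hI : IsAdmissible I) (ha : numArrows s t ≠ 0) (hD : 1 < cornerDim I s t) :
    ¬ IsLieAbelian (HH1 k (PathAlgebra k V ⧸ I)) := by
  intro hab
  have hab := isLieAbelian_HH1_iff.1 hab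
  obtain ⟨⟨e⟩, -⟩ := Nat.card_ne_zero.1 ha
  obtain ⟨χ, hχe, hχ⟩ := hQ.exists_arrow_cocycle hI e
  have hw : ∃ w ∈ corner I s t, ∀ c : k, c • pathClass I e.toPath ≠ w := by
    by_contra! h
    refine absurd hD (not_lt.2 ?_)
    rw [← finrank_corner]
    refine finrank_le_one ⟨_, pathClass_mem_corner e.toPath⟩ fun w => ?_
    obtain ⟨c, hc⟩ := h w.1 w.2
    exact ⟨c, Subtype.ext hc⟩
  obtain ⟨w, hw, hwe⟩ := hw
  obtain ⟨a, ha⟩ := hab ⟨_, hχ _ (pathClass_mem_corner e.toPath)⟩ ⟨_, hχ w hw⟩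
  have h1 := congrArg (fun f => vertexClass I s * f (pathClass I e.toPath) * vertexClass I t) ha
  obtain ⟨c, hc⟩ := hQ.coboundary_toPath e a
  have h2 : (⁅(⟨_, hχ _ (pathClass_mem_corner e.toPath)⟩ : hochschildZ1 k (PathAlgebra k V ⧸ I)),
      (⟨_, hχ w hw⟩ : hochschildZ1 k (PathAlgebra k V ⧸ I))⁆ :
        hochschildZ1 k (PathAlgebra k V ⧸ I)).1 (pathClass I e.toPath) =
      χ w • pathClass I e.toPath - w := by
    rw [hochschildZ1_lie_apply]
    simp only [LinearMap.smulRight_apply, hχe, one_smul]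
  have h3 := hc.symm.trans (h1.trans (congrArg
    (fun v => vertexClass I s * v * vertexClass I t) h2))
  simp only [mul_sub, sub_mul, mul_smul_comm, smul_mul_assoc, vertexClass_mul_pathClass,
    pathClass_mul_vertexClass, vertexClass_mul_of_mem_corner hw,
    mul_vertexClass_of_mem_corner hw] at h3
  refine hwe (χ w - c) ?_
  rw [sub_smul, h3]
  abel

end Corner

end ToupieAlg

namespace ToupieAlg

/-! ### Weights of cocycles -/

section ArrowWeights

attribute [local instance 100] LieRing.ofAssociativeRing

theorem pathWeight_add {k : Type u} [AddCommMonoid k] {V : Type v} [Quiver.{w} V]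
    (c d : ∀ x y : V, (x ⟶ y) → k) {x y : V} (p : Path x y) :
    pathWeight (fun x y e => c x y e + d x y e) p = pathWeight c p + pathWeight d p := by
  induction p with
  | nil => simp
  | cons p e ih => simp only [pathWeight_cons, ih]; exact add_add_add_comm _ _ _ _

theorem pathWeight_mul {k : Type u} [NonUnitalNonAssocSemiring k] {V : Type v} [Quiver.{w} V]
    (a : k) (c : ∀ x y : V, (x ⟶ y) → k) {x y : V} (p : Path x y) :
    pathWeight (fun x y e => a * c x y e) p = a * pathWeight c p := by
  induction p with
  | nil => simp
  | cons p e ih => simp only [pathWeight_cons, ih, mul_add]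

variable {k : Type u} [Field k] {V : Type v} [Fintype V] [Quiver.{w} V] {s t : V}
  {I : Ideal (PathAlgebra k V)} [I.IsTwoSided]

/-- The coefficients with which the arrows occur in their images under an endomorphism. -/
def HasArrowWeights (f : Module.End k (PathAlgebra k V ⧸ I)) (c : ∀ x y : V, (x ⟶ y) → k) :
    Prop :=
  ∀ (x y : V) (e : x ⟶ y),
    vertexClass I x * f (pathClass I e.toPath) * vertexClass I y = c x y e • pathClass I e.toPath

/-- Arrows are nonzero in an admissible quotient. Uniqueness makes it possible to compare the
weights of a cocycle with those of a coboundary. -/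
theorem HasArrowWeights.unique (hI : IsAdmissible I) {f : Module.End k (PathAlgebra k V ⧸ I)}
    {c d : ∀ x y : V, (x ⟶ y) → k} (hc : HasArrowWeights f c) (hd : HasArrowWeights f d) :
    c = d := by
  funext x y e
  exact smul_left_injective k (hI.pathClass_toPath_ne_zero e) ((hc x y e).symm.trans (hd x y e))

theorem HasArrowWeights.sub {f g : Module.End k (PathAlgebra k V ⧸ I)}
    {c d : ∀ x y : V, (x ⟶ y) → k} (hc : HasArrowWeights f c) (hd : HasArrowWeights g d) :
    HasArrowWeights (f - g) (fun x y e => c x y e + -1 * d x y e) := by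
  intro x y e
  change _ = (c x y e + -1 * d x y e) • _
  rw [LinearMap.sub_apply, mul_sub, sub_mul, hc, hd, ← sub_smul, neg_one_mul, ← sub_eq_add_neg]

/-- The Leibniz rule, compressed to a corner, adds weights along a path. The cocycle need not kill
the idempotents: `e_x f(e_x) e_x = 0` for every derivation. -/
theorem HasArrowWeights.corner_pathClass {f : Module.End k (PathAlgebra k V ⧸ I)}
    {c : ∀ x y : V, (x ⟶ y) → k} (hc : HasArrowWeights f c)
    (hf : f ∈ hochschildZ1 k (PathAlgebra k V ⧸ I)) {x y : V} (p : Path x y) :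
    vertexClass I x * f (pathClass I p) * vertexClass I y = pathWeight c p • pathClass I p := by
  have hf := mem_hochschildZ1.1 hf
  induction p with
  | nil =>
    have h := congrArg (vertexClass I x * ·) (hf (vertexClass I x) (vertexClass I x))
    simp only [vertexClass_mul_self, mul_add, ← mul_assoc] at h
    rw [pathClass_nil, pathWeight_nil, zero_smul]
    exact left_eq_add.1 h
  | @cons y z p e ih =>
    have h : pathClass I (p.cons e) = pathClass I p * pathClass I e.toPath :=
      (pathClass_mul p e.toPath).symm
    have h1 : vertexClass I x * (pathClass I p * f (pathClass I e.toPath)) * vertexClass I z =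
        pathClass I p * (vertexClass I y * f (pathClass I e.toPath) * vertexClass I z) := by
      simp only [← mul_assoc, vertexClass_mul_pathClass, pathClass_mul_vertexClass]
    have h2 : vertexClass I x * (f (pathClass I p) * pathClass I e.toPath) * vertexClass I z =
        vertexClass I x * f (pathClass I p) * vertexClass I y * pathClass I e.toPath := by
      simp only [mul_assoc, vertexClass_mul_pathClass, pathClass_mul_vertexClass]
    rw [h, hf, mul_add, add_mul, h1, h2, ih, hc, mul_smul_comm, smul_mul_assoc, ← add_smul,
      pathWeight_cons, add_comm]

/-- On the branches, `f` compressed to their corner is scaling by the weights; being defined on the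
quotient, it sends relations to zero. -/
theorem HasArrowWeights.scaleBranches_mem {f : Module.End k (PathAlgebra k V ⧸ I)}
    {c : ∀ x y : V, (x ⟶ y) → k} (hc : HasArrowWeights f c)
    (hf : f ∈ hochschildZ1 k (PathAlgebra k V ⧸ I)) {ρ : Path s t →₀ k}
    (hρ : ρ ∈ relationSpace I s t) :
    scaleBranches (fun b => pathWeight c b) ρ ∈ relationSpace I s t := by
  have hsmul : ∀ (c : k) (f : PathAlgebra k V),
    Ideal.Quotient.mk I (c • f) = c • Ideal.Quotient.mk I f := fun _ _ => rfl
  have key : ∀ ρ : Path s t →₀ k, Ideal.Quotient.mk I (Finsupp.linearCombination k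
      (fun b : Path s t => PathAlgebra.ofPath k b) (scaleBranches (fun b => pathWeight c b) ρ)) =
      vertexClass I s * f (Ideal.Quotient.mk I (Finsupp.linearCombination k
        (fun b : Path s t => PathAlgebra.ofPath k b) ρ)) * vertexClass I t := by
    intro ρ
    induction ρ using Finsupp.induction_linear with
    | zero => simp
    | add ρ σ hρ hσ => simp only [map_add, hρ, hσ, mul_add, add_mul]
    | single b a =>
      rw [scaleBranches, Finsupp.linearCombination_single, map_smul,
        Finsupp.linearCombination_single, Finsupp.linearCombination_single, hsmul, hsmul, hsmul,
        map_smul, mul_smul_comm, smul_mul_assoc]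
      exact congrArg _ (hc.corner_pathClass hf b).symm
  rw [mem_relationSpace, ← Ideal.Quotient.eq_zero_iff_mem, key,
    Ideal.Quotient.eq_zero_iff_mem.2 (mem_relationSpace.1 hρ), map_zero, mul_zero, zero_mul]

/-- Without cycles, `e_x a e_x = μ x • e_x`. So the weights of a coboundary come from a potential
`μ` and give all branches the same total. -/
theorem IsToupie.hasArrowWeights_coboundary (hQ : IsToupie s t) (a : PathAlgebra k V ⧸ I) :
    ∃ μ : V → k, HasArrowWeights (hochschildD0 k (PathAlgebra k V ⧸ I) a)
      (fun x y _ => μ y - μ x) := by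
  choose μ hμ using fun x => hQ.corner_self (I := I) x a
  refine ⟨μ, fun x y e => ?_⟩
  have h1 : vertexClass I x * (pathClass I e.toPath * a) * vertexClass I y =
      pathClass I e.toPath * (vertexClass I y * a * vertexClass I y) := by
    simp only [← mul_assoc, vertexClass_mul_pathClass, pathClass_mul_vertexClass]
  have h2 : vertexClass I x * (a * pathClass I e.toPath) * vertexClass I y =
      vertexClass I x * a * vertexClass I x * pathClass I e.toPath := by
    simp only [mul_assoc, vertexClass_mul_pathClass, pathClass_mul_vertexClass]
  rw [hochschildD0_apply, mul_sub, sub_mul, h1, h2, hμ, hμ, mul_smul_comm, smul_mul_assoc,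
    pathClass_mul_vertexClass, vertexClass_mul_pathClass, sub_smul]

/-- A diagonal cocycle with constant weights on the branches is a coboundary. -/
theorem IsToupie.exists_coboundary_of_diagonal (hQ : IsToupie s t)
    {f : Module.End k (PathAlgebra k V ⧸ I)} {c : ∀ x y : V, (x ⟶ y) → k}
    (hf : ∀ (x y : V) (p : Path x y), f (pathClass I p) = pathWeight c p • pathClass I p)
    {ν : k} (hν : ∀ b : Path s t, pathWeight c b = ν) :
    ∃ a, hochschildD0 k (PathAlgebra k V ⧸ I) a = f := by
  classical
  let P : ∀ x : V, Path s x := fun x => Classical.choice (hQ.nonempty_path x)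
  have hP : ∀ {x : V} (p : Path s x), pathWeight c p = pathWeight c (P x) := by
    intro x p
    by_cases hx : x = t
    · subst hx
      rw [hν, hν]
    · have := hQ.subsingleton_path_of_ne_sink (x := s) hx
      rw [Subsingleton.elim p (P x)]
  -- The potential at `x` is the weight of any path from the source to `x`; at the sink its
  -- independence of the path is the hypothesis `hν`.
  refine ⟨∑ x, pathWeight c (P x) • vertexClass I x, quotient_hom_ext fun x y p => ?_⟩
  have h1 : pathWeight c (P x) + pathWeight c p = pathWeight c (P y) := by
    rw [← pathWeight_comp, hP]
  rw [hf, hochschildD0_apply, Finset.mul_sum, Finset.sum_mul, Finset.sum_eq_single y,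
    Finset.sum_eq_single x, mul_smul_comm, smul_mul_assoc, pathClass_mul_vertexClass,
    vertexClass_mul_pathClass, ← sub_smul, ← h1, add_sub_cancel_left]
  · intro z _ hz
    rw [smul_mul_assoc, ← pathClass_nil, pathClass_mul_of_ne hz, smul_zero]
  · intro h
    exact absurd (Finset.mem_univ x) h
  · intro z _ hz
    rw [mul_smul_comm, ← pathClass_nil, pathClass_mul_of_ne hz.symm, smul_zero]
  · intro h
    exact absurd (Finset.mem_univ y) h

/-- Potentials telescope along branches. Conversely, subtracting the coboundary that makes `f`
diagonal shifts all branch weights by one constant, so a diagonal cocycle with constant branch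
weights remains. -/
theorem HasArrowWeights.mem_hochschildB1_iff {f : hochschildZ1 k (PathAlgebra k V ⧸ I)}
    {c : ∀ x y : V, (x ⟶ y) → k} (hc : HasArrowWeights f.1 c) (hQ : IsToupie s t)
    (hI : IsAdmissible I) (hA : ArrowsSpanCorners I) :
    f ∈ hochschildB1 k (PathAlgebra k V ⧸ I) ↔ ∃ ν, ∀ b : Path s t, pathWeight c b = ν := by
  rw [mem_hochschildB1]
  constructor
  · rintro ⟨a, ha⟩
    obtain ⟨μ, hμ⟩ := hQ.hasArrowWeights_coboundary a
    rw [ha] at hμ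
    obtain rfl := hc.unique hI hμ
    exact ⟨μ t - μ s, fun b => pathWeight_sub_of_potential μ b⟩
  · rintro ⟨ν, hν⟩
    obtain ⟨a, d, hd⟩ := hA.exists_diagonal f.2
    obtain ⟨μ, hμ⟩ := hQ.hasArrowWeights_coboundary a
    have hd' : HasArrowWeights (f.1 - hochschildD0 k _ a) d := by
      intro x y e
      rw [hd, mul_smul_comm, smul_mul_assoc, vertexClass_mul_pathClass, pathClass_mul_vertexClass,
        Hom.toPath, pathWeight_cons, pathWeight_nil, zero_add]
    obtain rfl := hd'.unique hI (hc.sub hμ)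
    obtain ⟨b, hb⟩ := hQ.exists_coboundary_of_diagonal hd (ν := ν + -1 * (μ t - μ s)) fun b => by
      rw [pathWeight_add, pathWeight_mul, pathWeight_sub_of_potential μ b, hν]
    refine ⟨b + a, ?_⟩
    rw [map_add, hb, sub_add_cancel]

/-- Diagonal cocycles with prescribed weights on the branches. -/
theorem IsToupie.exists_diagonal_cocycle [∀ x y : V, Finite (x ⟶ y)] [LinearOrder (Path s t)]
    (hQ : IsToupie s t) (hI : IsAdmissible I) {l : Path s t → k}
    (hl : ∀ b c, (relationGraph I s t).Adj b c → l b.1 = l c.1) :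
    ∃ f ∈ hochschildZ1 k (PathAlgebra k V ⧸ I), ∃ c, HasArrowWeights f c ∧
      ∀ b : Path s t, pathWeight c b = l b := by
  have hsmul : ∀ (c : k) (f : PathAlgebra k V),
    Ideal.Quotient.mk I (c • f) = c • Ideal.Quotient.mk I f := fun _ _ => rfl
  have := hQ.finite_branches
  obtain ⟨c, hc⟩ := hQ.exists_pathWeight_eq l
  let d : PathAlgebra k V →ₗ[k] PathAlgebra k V ⧸ I :=
    PathAlgebra.lift fun p => pathWeight c p.2.2 • pathClass I p.2.2
  have hd : ∀ {x y : V} (p : Path x y), d (PathAlgebra.ofPath k p) =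
      pathWeight c p • pathClass I p := fun p => PathAlgebra.lift_single _ _
  -- Elements of `I` split into their corners. In the corner of the branches this is
  -- `IsAdmissible.scaleBranches_mem`; any other corner contains at most one path, on which `d` is a
  -- scalar multiple of the projection.
  have hdI : ∀ f ∈ I, d f = 0 := by
    intro f hf
    rw [← PathAlgebra.sum_vertex_mul_mul_vertex f, map_sum]
    refine Finset.sum_eq_zero fun x _ => ?_
    rw [map_sum]
    refine Finset.sum_eq_zero fun y _ => ?_
    have hfI : PathAlgebra.vertex k x * f * PathAlgebra.vertex k y ∈ I :=
      I.mul_mem_right _ (I.mul_mem_left _ hf)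
    obtain ⟨ρ, hρ⟩ := Finsupp.mem_span_range_iff_exists_finsupp.1
      (PathAlgebra.vertex_mul_mul_vertex_mem f x y)
    by_cases hxy : x = s ∧ y = t
    · obtain ⟨rfl, rfl⟩ := hxy
      have h1 : ρ ∈ relationSpace I x y := by
        rw [mem_relationSpace, Finsupp.linearCombination_apply, hρ]
        exact hfI
      have h2 := mem_relationSpace.1 (hI.scaleBranches_mem hl h1)
      have key : ∀ ρ : Path x y →₀ k, d (Finsupp.linearCombination k
          (fun b : Path x y => PathAlgebra.ofPath k b) ρ) =
          Ideal.Quotient.mk I (Finsupp.linearCombination k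
            (fun b : Path x y => PathAlgebra.ofPath k b) (scaleBranches l ρ)) := by
        intro ρ
        induction ρ using Finsupp.induction_linear with
        | zero => simp
        | add ρ σ hρ hσ => simp only [map_add, hρ, hσ]
        | single b a =>
          rw [scaleBranches, Finsupp.linearCombination_single, Finsupp.linearCombination_single,
            map_smul, map_smul, Finsupp.linearCombination_single, hd, hsmul, hsmul, hc]
          rfl
      rw [← hρ, ← Finsupp.linearCombination_apply, key, Ideal.Quotient.eq_zero_iff_mem.2 h2]
    · have := hQ.subsingleton_path hxy
      rw [← hρ] at hfI ⊢
      rcases isEmpty_or_nonempty (Path x y) with he | ⟨⟨p⟩⟩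
      · rw [Subsingleton.elim ρ 0, Finsupp.sum_zero_index, map_zero]
      · have h1 : ρ = Finsupp.single p (ρ p) := by
          ext q
          rw [Subsingleton.elim q p, Finsupp.single_eq_same]
        have h2 : (Finsupp.single p (ρ p)).sum (fun i a => a • PathAlgebra.ofPath k i) =
            ρ p • PathAlgebra.ofPath k p := Finsupp.sum_single_index (zero_smul _ _)
        rw [h1, h2] at hfI ⊢
        rw [map_smul, hd, smul_comm]
        exact (congrArg _ (Ideal.Quotient.eq_zero_iff_mem.2 hfI)).trans (smul_zero _)
  obtain ⟨F, hF, hFd⟩ := exists_cocycle d hdI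
    (fun x y z p q => by
      rw [hd, hd, hd, mul_smul_comm, smul_mul_assoc, pathClass_mul, ← add_smul, pathWeight_comp,
        add_comm])
    (fun x y y' z p q hy => by
      rw [hd, hd, mul_smul_comm, smul_mul_assoc, pathClass_mul_of_ne hy, smul_zero, smul_zero,
        add_zero])
  refine ⟨F, hF, c, fun x y e => ?_, hc⟩
  have h1 : F (pathClass I e.toPath) = pathWeight c e.toPath • pathClass I e.toPath :=
    (hFd _).trans (hd _)
  rw [h1, mul_smul_comm, smul_mul_assoc, vertexClass_mul_pathClass, pathClass_mul_vertexClass,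
    Hom.toPath, pathWeight_cons, pathWeight_nil, zero_add]

variable (s t) in
/-- The weights of the branches depend linearly on the cocycle. -/
theorem IsAdmissible.exists_branchWeight (hI : IsAdmissible I) :
    ∃ Ψ : hochschildZ1 k (PathAlgebra k V ⧸ I) →ₗ[k] (Path s t → k),
      ∀ f c, HasArrowWeights f.1 c → ∀ b, Ψ f b = pathWeight c b := by
  have hχ : ∀ (x y : V) (e : x ⟶ y), ∃ χ : (PathAlgebra k V ⧸ I) →ₗ[k] k,
      χ (pathClass I e.toPath) = 1 := by
    intro x y e
    obtain ⟨χ, hχ⟩ := exists_quotient_lift (I := I) (PathAlgebra.coeff k ⟨x, y, e.toPath⟩)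
      (fun f hf => hI.coeff_eq_zero hf (by simp))
    exact ⟨χ, (hχ _).trans (PathAlgebra.coeff_ofPath_self _)⟩
  choose χ hχ using hχ
  -- This reads off the coefficient of each arrow, linearly in `f` and for every `f`; it agrees with
  -- the arrow weights whenever these exist.
  let c : Module.End k (PathAlgebra k V ⧸ I) → ∀ x y : V, (x ⟶ y) → k := fun f x y e =>
    χ x y e (vertexClass I x * f (pathClass I e.toPath) * vertexClass I y)
  refine ⟨{ toFun := fun f b => pathWeight (c f.1) b, map_add' := ?_, map_smul' := ?_ }, ?_⟩
  · intro f g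
    funext b
    rw [Pi.add_apply, ← pathWeight_add]
    congr 1
    funext x y e
    change χ x y e (vertexClass I x * (f.1 _ + g.1 _) * vertexClass I y) = _
    rw [mul_add, add_mul, map_add]
  · intro a f
    funext b
    rw [Pi.smul_apply, RingHom.id_apply, smul_eq_mul, ← pathWeight_mul]
    congr 1
    funext x y e
    change χ x y e (vertexClass I x * (a • f.1 _) * vertexClass I y) = _
    rw [mul_smul_comm, smul_mul_assoc, map_smul, smul_eq_mul]
  · intro f d hd b
    change pathWeight (c f.1) b = _
    congr 1
    funext x y e
    change χ x y e _ = _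
    rw [hd, map_smul, hχ, smul_eq_mul, mul_one]

theorem ArrowsSpanCorners.exists_hasArrowWeights (hA : ArrowsSpanCorners I)
    (f : Module.End k (PathAlgebra k V ⧸ I)) : ∃ c, HasArrowWeights f c := by
  choose c hc using fun x y e => hA x y e (f (pathClass I e.toPath))
  exact ⟨c, hc⟩

end ArrowWeights

/-! ### The dimension of the first Hochschild cohomology -/

section Dimension

attribute [local instance 100] LieRing.ofAssociativeRing

variable {k : Type u} [Field k] {V : Type v} [Fintype V] [Quiver.{w} V] {s t : V}
  {I : Ideal (PathAlgebra k V)} [LinearOrder (Path s t)]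

variable (s t I) in
/-- The classes of branches on which weights of cocycles are constant: connected components of the
graph of relations, branches containing monomial relations, and arrows. -/
abbrev BranchClass : Type max v w :=
  (relationGraph I s t).ConnectedComponent ⊕ {b : Path s t // ContainsMonomialRelation I b} ⊕
    {b : Path s t // b.length = 1}

theorem IsToupie.card_branchClass [∀ x y : V, Finite (x ⟶ y)] (hQ : IsToupie s t) :
    Nat.card (BranchClass s t I) =
      numComponents I s t + numMonomialBranches I s t + numArrows s t := by
  have := hQ.finite_branches
  have h : Nat.card {b : Path s t // b.length = 1} = Nat.card (s ⟶ t) := by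
    refine (Nat.card_congr (Equiv.ofBijective
      (fun e : s ⟶ t => (⟨e.toPath, by simp⟩ : {b : Path s t // b.length = 1})) ⟨?_, ?_⟩)).symm
    · intro e e' h
      exact toPath_injective (congrArg Subtype.val h)
    · rintro ⟨b, hb⟩
      obtain ⟨e, rfl⟩ := b.exists_eq_toPath_of_length_eq_one hb
      exact ⟨e, rfl⟩
  rw [Nat.card_sum, Nat.card_sum, h, add_assoc]
  rfl

variable [I.IsTwoSided]

/-- An arrow contains no monomial relation, so each branch is of exactly one of the three kinds.
Only vertices of the graph are identified, so a function is constant along edges iff it factors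
through `κ`. -/
theorem IsToupie.exists_branchClass (hQ : IsToupie s t) (hI : IsAdmissible I) :
    ∃ κ : Path s t → BranchClass s t I, Function.Surjective κ ∧ ∀ l : Path s t → k,
      (∀ b c, (relationGraph I s t).Adj b c → l b.1 = l c.1) ↔
        ∀ b c, κ b = κ c → l b = l c := by
  classical
  let κ : Path s t → BranchClass s t I := fun b =>
    if hb : ContainsMonomialRelation I b then Sum.inr (Sum.inl ⟨b, hb⟩)
    else if hb' : 2 ≤ b.length then
      Sum.inl ((relationGraph I s t).connectedComponentMk ⟨b, hb', hb⟩)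
    else Sum.inr (Sum.inr ⟨b, by have := hQ.length_pos b; omega⟩)
  have h1 : ∀ (b : Path s t) (hb : ContainsMonomialRelation I b),
      κ b = Sum.inr (Sum.inl ⟨b, hb⟩) := fun b hb => dif_pos hb
  have h2 : ∀ (b : Path s t) (hb : ¬ ContainsMonomialRelation I b) (hb' : 2 ≤ b.length),
      κ b = Sum.inl ((relationGraph I s t).connectedComponentMk ⟨b, hb', hb⟩) :=
    fun b hb hb' => (dif_neg hb).trans (dif_pos hb')
  have h3 : ∀ (b : Path s t) (hb : b.length = 1), κ b = Sum.inr (Sum.inr ⟨b, hb⟩) := by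
    intro b hb
    have hbm : ¬ ContainsMonomialRelation I b := fun h => by
      have := hI.two_le_length (single_mem_relationSpace h) (b := b) (by simp)
      omega
    exact (dif_neg hbm).trans (dif_neg (by omega))
  refine ⟨κ, ?_, fun l => ⟨fun hl b c hbc => ?_, fun hl b c hbc => hl _ _ ?_⟩⟩
  · rintro (C | ⟨b, hb⟩ | ⟨b, hb⟩)
    · induction C using SimpleGraph.ConnectedComponent.ind with
      | _ b => exact ⟨b.1, h2 b.1 b.2.2 b.2.1⟩
    · exact ⟨b, h1 b hb⟩
    · exact ⟨b, h3 b hb⟩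
  · have hr : ∀ b c, (relationGraph I s t).Reachable b c → l b.1 = l c.1 := by
      rintro b c ⟨p⟩
      induction p with
      | nil => rfl
      | cons h _ ih => exact (hl _ _ h).trans ih
    by_cases hb : ContainsMonomialRelation I b
    · by_cases hc : ContainsMonomialRelation I c
      · rw [h1 b hb, h1 c hc] at hbc
        have h := congrArg Subtype.val (Sum.inl_injective (Sum.inr_injective hbc))
        exact congrArg l h
      · by_cases hc' : 2 ≤ c.length
        · rw [h1 b hb, h2 c hc hc'] at hbc
          cases hbc
        · rw [h1 b hb, h3 c (by have := hQ.length_pos c; omega)] at hbc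
          cases hbc
    · by_cases hb' : 2 ≤ b.length
      · by_cases hc : ContainsMonomialRelation I c
        · rw [h2 b hb hb', h1 c hc] at hbc
          cases hbc
        · by_cases hc' : 2 ≤ c.length
          · rw [h2 b hb hb', h2 c hc hc'] at hbc
            exact hr _ _ (SimpleGraph.ConnectedComponent.exact (Sum.inl_injective hbc))
          · rw [h2 b hb hb', h3 c (by have := hQ.length_pos c; omega)] at hbc
            cases hbc
      · have hb1 : b.length = 1 := by have := hQ.length_pos b; omega
        by_cases hc : ContainsMonomialRelation I c
        · rw [h3 b hb1, h1 c hc] at hbc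
          cases hbc
        · by_cases hc' : 2 ≤ c.length
          · rw [h3 b hb1, h2 c hc hc'] at hbc
            cases hbc
          · rw [h3 b hb1, h3 c (by have := hQ.length_pos c; omega)] at hbc
            have h := congrArg Subtype.val (Sum.inr_injective (Sum.inr_injective hbc))
            exact congrArg l h
  · rw [h2 b.1 b.2.2 b.2.1, h2 c.1 c.2.2 c.2.1]
    exact congrArg Sum.inl (SimpleGraph.ConnectedComponent.sound hbc.reachable)

/-- If the arrows span the corners in which they lie, then the first Hochschild cohomology is the
space of functions on the classes of branches modulo the constant functions. -/
theorem ArrowsSpanCorners.nonempty_HH1_equiv [∀ x y : V, Finite (x ⟶ y)]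
    (hA : ArrowsSpanCorners I) (hQ : IsToupie s t) (hI : IsAdmissible I) :
    Nonempty (HH1 k (PathAlgebra k V ⧸ I) ≃ₗ[k]
      (BranchClass s t I → k) ⧸ Submodule.span k {(1 : BranchClass s t I → k)}) := by
  have := hQ.finite_branches
  obtain ⟨Ψ, hΨ⟩ := hI.exists_branchWeight s t
  obtain ⟨κ, hκ, hκl⟩ := hQ.exists_branchClass hI
  -- A section of `κ` turns weights that are constant on classes into functions on the classes.
  obtain ⟨σ, hσ⟩ := hκ.hasRightInverse
  have hconst : ∀ f b c, κ b = κ c → Ψ f b = Ψ f c := by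
    intro f
    refine (hκl _).1 fun b c hbc => ?_
    obtain ⟨-, ρ, hρ, hb, hc⟩ := hbc
    obtain ⟨d, hd⟩ := hA.exists_hasArrowWeights f.1
    rw [hΨ f d hd, hΨ f d hd]
    exact hρ.eq_of_scaleBranches (fun ρ hρ => hd.scaleBranches_mem f.2 hρ) hb hc
  let Φ : hochschildZ1 k (PathAlgebra k V ⧸ I) →ₗ[k] (BranchClass s t I → k) :=
    LinearMap.funLeft k k σ ∘ₗ Ψ
  have hΦ : ∀ f b, Φ f (κ b) = Ψ f b := fun f b => hconst f _ _ (hσ (κ b))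
  let S := Submodule.span k {(1 : BranchClass s t I → k)}
  have hsurj : Function.Surjective (S.mkQ ∘ₗ Φ) := by
    refine (Submodule.mkQ_surjective S).comp fun g => ?_
    obtain ⟨f, hf, c, hc, hcb⟩ := hQ.exists_diagonal_cocycle hI
      ((hκl (g ∘ κ)).2 fun b c h => congrArg g h)
    refine ⟨⟨f, hf⟩, ?_⟩
    funext C
    obtain ⟨b, rfl⟩ := hκ C
    rw [hΦ, hΨ _ c hc, hcb]
    rfl
  have hker : (hochschildB1 k (PathAlgebra k V ⧸ I)).toSubmodule = LinearMap.ker (S.mkQ ∘ₗ Φ) := by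
    ext f
    obtain ⟨c, hc⟩ := hA.exists_hasArrowWeights f.1
    rw [LieSubmodule.mem_toSubmodule, hc.mem_hochschildB1_iff hQ hI hA, LinearMap.mem_ker,
      LinearMap.comp_apply, Submodule.mkQ_apply, Submodule.Quotient.mk_eq_zero,
      Submodule.mem_span_singleton]
    refine exists_congr fun ν => ⟨fun h => ?_, fun h b => ?_⟩
    · funext C
      obtain ⟨b, rfl⟩ := hκ C
      rw [hΦ, hΨ f c hc, h, Pi.smul_apply, Pi.one_apply, smul_eq_mul, mul_one]
    · rw [← hΨ f c hc, ← hΦ, ← h, Pi.smul_apply, Pi.one_apply, smul_eq_mul, mul_one]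
  exact ⟨(Submodule.quotEquivOfEq _ _ hker).trans
    ((S.mkQ ∘ₗ Φ).quotKerEquivOfSurjective hsurj)⟩

/-- The constants account for the difference between `n + 1` classes and dimension `n`. Writing `n +
1` also ensures that a class exists, so that the constant function 1 is nonzero. -/
theorem ArrowsSpanCorners.nonempty_enveloping_equiv [∀ x y : V, Finite (x ⟶ y)]
    (hA : ArrowsSpanCorners I) (hQ : IsToupie s t) (hI : IsAdmissible I) {n : ℕ}
    (hn : numComponents I s t + numMonomialBranches I s t + numArrows s t = n + 1) :
    Nonempty (UniversalEnvelopingAlgebra k (HH1 k (PathAlgebra k V ⧸ I)) ≃ₐ[k]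
      MvPolynomial (Fin n) k) := by
  have := hQ.finite_branches
  have := hA.isLieAbelian
  obtain ⟨Φ⟩ := hA.nonempty_HH1_equiv hQ hI
  rw [← hQ.card_branchClass] at hn
  cases nonempty_fintype (BranchClass s t I)
  have : Nonempty (BranchClass s t I) := (Nat.card_pos_iff.1 (by omega)).1
  have := Module.Finite.equiv Φ.symm
  have hdim : Module.finrank k (HH1 k (PathAlgebra k V ⧸ I)) = n := by
    rw [Φ.finrank_eq, Submodule.finrank_quotient, finrank_span_singleton one_ne_zero,
      Module.finrank_pi, ← Nat.card_eq_fintype_card, hn, Nat.add_sub_cancel]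
  exact UniversalEnvelopingAlgebra.nonempty_equiv_mvPolynomial
    (Module.finBasisOfFinrankEq k _ hdim)

/-- If the corner at the source and the sink is spanned by an arrow, then all other branches lie in
the ideal. -/
theorem IsToupie.numComponents_eq_zero [∀ x y : V, Finite (x ⟶ y)] (hQ : IsToupie s t)
    (hI : IsAdmissible I) (ha : numArrows s t ≠ 0) (hD : cornerDim I s t ≤ 1) :
    numComponents I s t = 0 := by
  obtain ⟨⟨e⟩, -⟩ := Nat.card_ne_zero.1 ha
  have hA := hQ.arrowsSpanCorners hI (Or.inr hD)
  have : IsEmpty {b : Path s t // 2 ≤ b.length ∧ ¬ ContainsMonomialRelation I b} := by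
    -- The whole branch serves as its own monomial relation: modulo `I` it is `c` times the arrow,
    -- and the coefficient of the arrow, well defined on the quotient, gives `c = 0`.
    refine ⟨fun ⟨b, hb, hbm⟩ => hbm ⟨s, t, Path.nil, b, Path.nil, by simp, ?_⟩⟩
    obtain ⟨c, hc⟩ := hA s t e (pathClass I b)
    rw [vertexClass_mul_pathClass, pathClass_mul_vertexClass] at hc
    obtain ⟨χ, hχ⟩ := exists_quotient_lift (I := I) (PathAlgebra.coeff k ⟨s, t, e.toPath⟩)
      (fun f hf => hI.coeff_eq_zero hf (by simp))
    have hbe : b ≠ e.toPath := by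
      rintro rfl
      simp at hb
    have h1 : χ (pathClass I b) = 0 := (hχ _).trans (PathAlgebra.coeff_ofPath_of_ne hbe)
    have h2 : χ (pathClass I e.toPath) = 1 := (hχ _).trans (PathAlgebra.coeff_ofPath_self _)
    rw [hc, map_smul, h2, smul_eq_mul, mul_one] at h1
    rw [h1, zero_smul] at hc
    exact Ideal.Quotient.eq_zero_iff_mem.1 hc
  have : IsEmpty (relationGraph I s t).ConnectedComponent :=
    ⟨fun C => C.ind fun b => isEmptyElim b⟩
  exact Nat.card_of_isEmpty

end Dimension

end ToupieAlg

theorem mainTheorem6 {k : Type u} [Field k] [CharZero k]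
    {V : Type v} [Fintype V] [Quiver.{w} V] [∀ x y : V, Finite (x ⟶ y)]
    {s t : V} (hQ : IsToupie s t) [LinearOrder (Quiver.Path s t)]
    (I : Ideal (PathAlgebra k V)) [I.IsTwoSided] (hI : IsAdmissible I) :
    (IsLieAbelian (HH1 k (PathAlgebra k V ⧸ I)) ↔ numArrows s t = 0 ∨ cornerDim I s t ≤ 1) ∧
    (numArrows s t = 0 →
      1 ≤ numComponents I s t + numMonomialBranches I s t ∧
      Nonempty (UniversalEnvelopingAlgebra k (HH1 k (PathAlgebra k V ⧸ I)) ≃ₐ[k]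
        MvPolynomial (Fin (numComponents I s t + numMonomialBranches I s t - 1)) k)) ∧
    (numArrows s t = 1 → cornerDim I s t = 1 →
      Nonempty (UniversalEnvelopingAlgebra k (HH1 k (PathAlgebra k V ⧸ I)) ≃ₐ[k]
        MvPolynomial (Fin (numMonomialBranches I s t)) k)) := by
  refine ⟨⟨fun h => ?_, fun h => (hQ.arrowsSpanCorners hI h).isLieAbelian⟩, fun ha => ?_,
    fun ha hD => ?_⟩
  · by_contra! hc
    exact hQ.not_isLieAbelian hI hc.1 hc.2 h
  · have := hQ.finite_branches
    -- The sink is reached from the source, so there is a branch and hence a class, which is not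
    -- that of an arrow.
    have hpos : 1 ≤ numComponents I s t + numMonomialBranches I s t := by
      obtain ⟨b⟩ := hQ.nonempty_path t
      obtain ⟨κ, -⟩ := hQ.exists_branchClass hI
      have : 0 < Nat.card (BranchClass s t I) := Nat.card_pos_iff.2 ⟨⟨κ b⟩, inferInstance⟩
      rw [hQ.card_branchClass, ha] at this
      omega
    exact ⟨hpos, (hQ.arrowsSpanCorners hI (Or.inl ha)).nonempty_enveloping_equiv hQ hI (by omega)⟩
  -- Here `r = 0` and `a = 1`, so there are `m + 1` classes.
  · refine (hQ.arrowsSpanCorners hI (Or.inr hD.le)).nonempty_enveloping_equiv hQ hI ?_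
    rw [hQ.numComponents_eq_zero hI (by omega) hD.le, ha, zero_add]
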